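/- Let $(M,g)$ be a smooth 4-dimensional spacetime of signature $(-,+,+,+)$ with Levi-Civita connection $\nabla$, and let $T=(\rho+p)\,u\otimes u+p\,g$ be a smooth perfect energy tensor ($g(u,u)=-1$, $\rho+p>0$) that is conserved ($\nabla\cdot T=0$), non-barotropic ($d\rho\wedge dp\neq0$ everywhere) and non-isoenergetic ($\dot\rho\neq0$ everywhere), where $\dot q=u(q)$. Put $\theta=\nabla_\alpha u^\alpha$ and let $\chi=\dot p/\dot\rho$ be the indicatrix of $T$. Thermodynamic quantities on an open set $D$ of the $(\rho,p)$-plane are smooth functions of state $r>0$ (matter density), $s$ (specific entropy) and $\Theta$ (temperature) on $D$ such that $\Theta\,ds=d\epsilon+p\,dv$, where $v=1/r$ and $\rho=r(1+\epsilon)$. The dynamic volume is $\tau=(1+\epsilon+pv)\,v$. Where $(s,p)$ are coordinates on the $(\rho,p)$-plane, i.e. $s'_\rho\ne0$, one says that - $\mathrm H_1$ holds if $(\tau'_p)_s<0$ and $(\tau''_p)_s>0$; - $\mathrm H_2$ holds if $(\tau'_s)_p>0$; - $\bar{\mathrm H}_2$ holds if $(\tau'_s)_p<0$. $T$ represents the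 evolution in local thermal equilibrium (l.t.e.) of a fluid satisfying given such conditions if every state $(\rho(x),p(x))$, $x\in M$, has an open neighbourhood $D$ in the $(\rho,p)$-plane with thermodynamic quantities $r,s,\Theta$ on $D$ that satisfy these conditions on $D$ and such that $\dot r+r\theta=0$ and $\dot s=0$ at all events whose state lies in $D$. Theorem. $T$ represents the l.t.e. evolution of a fluid satisfying $\mathrm H_1$ and $\mathrm H_2$ if and only if the indicatrix is a function of state, $\chi=\chi(\rho,p)$ (a smooth function on an open set containing all states of $T$), which satisfies at all states of $T$ $$0<\chi<1,\qquad (\rho+p)(\chi\chi'_p+\chi'_\rho)+2\chi(1-\chi)>0 .$$ The same equivalence holds with $\bar{\mathrm H}_2$ in place of $\mathrm H_2$. Moreover, every $T$ that satisfies this condition on $\chi$ can be endowed, around each of its states, with thermodynamic quantities as above, with $\Theta>0$, that solve $$\chi=-\frac{s'_\rho}{s'_p}=\frac1{r'_p}\Big[\frac r{\rho+p}-r'_\rho\Big]\qquad(s'_p\ne0,\ r'_p\neq0)$$ and satisfy $\mathrm H_1$ and whichever one wants of $\mathrm H_2$ and $\bar{\mathrm H}_2$. -/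

import Mathlib

open scoped Manifold ContDiff Topology

noncomputable section

/-! ## Spacetimes -/

/-- A smooth Lorentzian metric, of signature `(-,+,+,+)`, on a smooth 4-manifold. -/
structure LorentzMetric (M : Type*) [TopologicalSpace M]
    [ChartedSpace (EuclideanSpace ℝ (Fin 4)) M] [IsManifold (𝓡 4) ∞ M] where
  /-- The metric product of two vectors at a point. -/
  inner (x : M) : TangentSpace (𝓡 4) x →L[ℝ] TangentSpace (𝓡 4) x →L[ℝ] ℝ
  symm (x : M) (v w : TangentSpace (𝓡 4) x) : inner x v w = inner x w v
  /-- At each point there is an orthonormal frame with signs `(-1, 1, 1, 1)`. -/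
  signature (x : M) : ∃ b : Module.Basis (Fin 4) ℝ (TangentSpace (𝓡 4) x), ∀ i j,
    inner x (b i) (b j) = if i = j then (if i = 0 then -1 else 1) else 0
  contMDiff : ContMDiff (𝓡 4)
    ((𝓡 4).prod 𝓘(ℝ, EuclideanSpace ℝ (Fin 4) →L[ℝ] EuclideanSpace ℝ (Fin 4) →L[ℝ] ℝ)) ∞
    (fun x ↦ Bundle.TotalSpace.mk'
      (EuclideanSpace ℝ (Fin 4) →L[ℝ] EuclideanSpace ℝ (Fin 4) →L[ℝ] ℝ) x (inner x))

/-- Affine connections (covariant derivatives on the tangent bundle) of a 4-manifold.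
As everywhere in Mathlib, `nabla Y x v` is `(∇_v Y)(x)`. -/
abbrev AffineConnection (M : Type*) [TopologicalSpace M]
    [ChartedSpace (EuclideanSpace ℝ (Fin 4)) M] [IsManifold (𝓡 4) ∞ M] :=
  CovariantDerivative (𝓡 4) (EuclideanSpace ℝ (Fin 4)) (TangentSpace (𝓡 4) : M → Type _)

section Spacetime

variable {M : Type*} [TopologicalSpace M] [ChartedSpace (EuclideanSpace ℝ (Fin 4)) M]
  [IsManifold (𝓡 4) ∞ M]

/-- The vector field `Y` is differentiable at the point `x`. -/
def FieldDiffAt (Y : Π x : M, TangentSpace (𝓡 4) x) (x : M) : Prop :=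
  MDifferentiableAt (𝓡 4) (𝓡 4).tangent
    (fun y ↦ Bundle.TotalSpace.mk' (EuclideanSpace ℝ (Fin 4)) y (Y y)) x

/-- The Levi-Civita connection of a Lorentzian metric: the (unique) connection that is
torsion-free and satisfies `v (g(X, Y)) = g(∇_v X, Y) + g(X, ∇_v Y)`. -/
structure IsLeviCivita (g : LorentzMetric M) (nabla : AffineConnection M) : Prop where
  torsion_eq_zero : nabla.torsion = 0
  metric (X Y : Π x : M, TangentSpace (𝓡 4) x) (x : M) (hX : FieldDiffAt X x)
    (hY : FieldDiffAt Y x) (v : TangentSpace (𝓡 4) x) :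
    mvfderiv (𝓡 4) (fun y ↦ g.inner y (X y) (Y y)) x v =
      g.inner x (nabla X x v) (Y x) + g.inner x (X x) (nabla Y x v)

/-- The divergence `∇_α Z^α` of a vector field. -/
def divergence (nabla : AffineConnection M) (Z : Π x : M, TangentSpace (𝓡 4) x) (x : M) : ℝ :=
  LinearMap.trace ℝ (TangentSpace (𝓡 4) x) (nabla Z x).toLinearMap

/-- The contraction `(∇_α T^α_β) Y^β = ∇_α (T^α_β Y^β) - T^α_β ∇_α Y^β` of the divergence of a
2-tensor (in mixed components) with a vector field. -/
def tensorDivergence (nabla : AffineConnection M)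
    (T : Π x : M, TangentSpace (𝓡 4) x →L[ℝ] TangentSpace (𝓡 4) x)
    (Y : Π x : M, TangentSpace (𝓡 4) x) (x : M) : ℝ :=
  divergence nabla (fun y ↦ T y (Y y)) x -
    LinearMap.trace ℝ (TangentSpace (𝓡 4) x) ((T x).comp (nabla Y x)).toLinearMap

/-- `∇ · T = 0`. -/
def IsDivergenceFree (nabla : AffineConnection M)
    (T : Π x : M, TangentSpace (𝓡 4) x →L[ℝ] TangentSpace (𝓡 4) x) : Prop :=
  ∀ (x : M) (Y : Π x : M, TangentSpace (𝓡 4) x), FieldDiffAt Y x →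
    tensorDivergence nabla T Y x = 0

/-! ## Perfect energy tensors -/

/-- The hydrodynamic quantities of a perfect energy tensor: unit velocity (timelike, `u² = -1`),
energy density, pressure. -/
structure PerfectEnergyTensor (g : LorentzMetric M) where
  /-- unit velocity -/
  u (x : M) : TangentSpace (𝓡 4) x
  /-- energy density -/
  ρ : M → ℝ
  /-- pressure -/
  p : M → ℝ
  unit (x : M) : g.inner x (u x) (u x) = -1
  u_smooth : ContMDiff (𝓡 4) (𝓡 4).tangent ∞
    (fun x ↦ Bundle.TotalSpace.mk' (EuclideanSpace ℝ (Fin 4)) x (u x))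
  ρ_smooth : ContMDiff (𝓡 4) 𝓘(ℝ, ℝ) ∞ ρ
  p_smooth : ContMDiff (𝓡 4) 𝓘(ℝ, ℝ) ∞ p

namespace PerfectEnergyTensor

variable {g : LorentzMetric M} (T : PerfectEnergyTensor g)

/-- The tensor `(ρ + p) u ⊗ u + p g`, in mixed components `(ρ + p) u^α u_β + p δ^α_β`. -/
def tensor (x : M) : TangentSpace (𝓡 4) x →L[ℝ] TangentSpace (𝓡 4) x :=
  (T.ρ x + T.p x) • (g.inner x (T.u x)).smulRight (T.u x) +
    T.p x • ContinuousLinearMap.id ℝ (TangentSpace (𝓡 4) x)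

/-- `T` is conserved: `∇ · T = 0`. -/
def IsConserved (nabla : AffineConnection M) : Prop :=
  IsDivergenceFree nabla T.tensor

/-- The derivative `q̇ = u(q)` of a quantity along the flow. -/
def dot (q : M → ℝ) (x : M) : ℝ :=
  mvfderiv (𝓡 4) q x (T.u x)

/-- Non barotropic: `dρ ∧ dp ≠ 0` everywhere. -/
def IsNonBarotropic : Prop :=
  ∀ x, LinearIndependent ℝ ![mvfderiv (𝓡 4) T.ρ x, mvfderiv (𝓡 4) T.p x]

/-- Non isoenergetic: `ρ̇ ≠ 0` everywhere. -/
def IsNonIsoenergetic : Prop :=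
  ∀ x, T.dot T.ρ x ≠ 0

/-- The indicatrix `χ = ṗ / ρ̇`. -/
def indicatrix (x : M) : ℝ :=
  T.dot T.p x / T.dot T.ρ x

/-- The thermodynamic state `(ρ, p)` of the fluid at an event. -/
def state (x : M) : ℝ × ℝ :=
  (T.ρ x, T.p x)

end PerfectEnergyTensor

end Spacetime

/-! ## Functions of state

The thermodynamic plane is `ℝ × ℝ`, with coordinates `(ρ, p)`. -/

/-- `z'_ρ`, the partial derivative at constant `p`. -/
def partialRho (z : ℝ × ℝ → ℝ) (e : ℝ × ℝ) : ℝ :=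
  deriv (fun a ↦ z (a, e.2)) e.1

/-- `z'_p`, the partial derivative at constant `ρ`. -/
def partialP (z : ℝ × ℝ → ℝ) (e : ℝ × ℝ) : ℝ :=
  deriv (fun b ↦ z (e.1, b)) e.2

/-- The specific volume `v = 1 / r`. -/
def specificVolume (r : ℝ × ℝ → ℝ) (e : ℝ × ℝ) : ℝ :=
  1 / r e

/-- The specific internal energy `ε`, given by `ρ = r (1 + ε)`. -/
def internalEnergy (r : ℝ × ℝ → ℝ) (e : ℝ × ℝ) : ℝ :=
  e.1 / r e - 1

/-- The specific enthalpy `i = ε + p v`. -/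
def enthalpy (r : ℝ × ℝ → ℝ) (e : ℝ × ℝ) : ℝ :=
  internalEnergy r e + e.2 * specificVolume r e

/-- The dynamic volume `τ = f v`, with `f = 1 + i` the enthalpy index (and `c = 1`). -/
def dynamicVolume (r : ℝ × ℝ → ℝ) (e : ℝ × ℝ) : ℝ :=
  (1 + enthalpy r e) * specificVolume r e

/-- `r` (matter density), `s` (specific entropy) and `Θ` (temperature) are functions of state, on
the open part `D` of the thermodynamic plane, that satisfy the energy balance
`Θ ds = dε + p dv`. -/
structure IsThermodynamics (D : Set (ℝ × ℝ)) (r s Θ : ℝ × ℝ → ℝ) : Prop where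
  isOpen : IsOpen D
  r_smooth : ContDiffOn ℝ ∞ r D
  s_smooth : ContDiffOn ℝ ∞ s D
  Θ_smooth : ContDiffOn ℝ ∞ Θ D
  r_pos : ∀ e ∈ D, 0 < r e
  balance : ∀ e ∈ D,
    Θ e • fderiv ℝ s e = fderiv ℝ (internalEnergy r) e + e.2 • fderiv ℝ (specificVolume r) e

/-- Near the state `e`, the pair `(s, p)` is a coordinate system of the thermodynamic plane
(that is, `s'_ρ ≠ 0`) and `z = zhat(s, p)`. -/
structure IsExpressedBy (s z zhat : ℝ × ℝ → ℝ) (e : ℝ × ℝ) : Prop where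
  coordinates : partialRho s e ≠ 0
  smooth : ContDiffAt ℝ ∞ zhat (s e, e.2)
  eq : ∀ᶠ e' in 𝓝 e, z e' = zhat (s e', e'.2)

/-- The compressibility conditions H₁ at a state: `(τ'_p)_s < 0` and `(τ''_p)_s > 0`. -/
def CondH1 (r s : ℝ × ℝ → ℝ) (e : ℝ × ℝ) : Prop :=
  ∃ τ, IsExpressedBy s (dynamicVolume r) τ e ∧
    deriv (fun b ↦ τ (s e, b)) e.2 < 0 ∧ 0 < iteratedDeriv 2 (fun b ↦ τ (s e, b)) e.2

/-- The compressibility condition H₂ at a state: `(τ'_s)_p > 0`. -/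
def CondH2 (r s : ℝ × ℝ → ℝ) (e : ℝ × ℝ) : Prop :=
  ∃ τ, IsExpressedBy s (dynamicVolume r) τ e ∧ 0 < deriv (fun a ↦ τ (a, e.2)) (s e)

/-- The opposite condition H̄₂ at a state: `(τ'_s)_p < 0`. -/
def CondH2bar (r s : ℝ × ℝ → ℝ) (e : ℝ × ℝ) : Prop :=
  ∃ τ, IsExpressedBy s (dynamicVolume r) τ e ∧ deriv (fun a ↦ τ (a, e.2)) (s e) < 0

/-- The H₁ inequalities for a function of state `χ(ρ, p)`:
`0 < χ < 1` and `(ρ + p)(χ χ'_p + χ'_ρ) + 2 χ (1 - χ) > 0`. -/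
def IndicatrixH1 (χ : ℝ × ℝ → ℝ) (e : ℝ × ℝ) : Prop :=
  0 < χ e ∧ χ e < 1 ∧
    0 < (e.1 + e.2) * (χ e * partialP χ e + partialRho χ e) + 2 * χ e * (1 - χ e)

/-- `r` and `s` solve `χ = -s'_ρ / s'_p = (1 / r'_p) (r / (ρ + p) - r'_ρ)` at a state,
with both denominators different from zero. -/
def SolvesSound (χ r s : ℝ × ℝ → ℝ) (e : ℝ × ℝ) : Prop :=
  partialP s e ≠ 0 ∧ partialP r e ≠ 0 ∧
    χ e = -partialRho s e / partialP s e ∧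
    χ e = 1 / partialP r e * (r e / (e.1 + e.2) - partialRho r e)

/-! ## Evolution in local thermal equilibrium -/

namespace PerfectEnergyTensor

variable {M : Type*} [TopologicalSpace M] [ChartedSpace (EuclideanSpace ℝ (Fin 4)) M]
  [IsManifold (𝓡 4) ∞ M] {g : LorentzMetric M} (T : PerfectEnergyTensor g)

/-- Evolution of the fluid with thermodynamic quantities `r`, `s` at all events whose state lies in
`D`: matter conservation `ṙ + r θ = 0`, with `θ = ∇ · u`, and local adiabaticity `ṡ = 0`. -/
def Evolves (nabla : AffineConnection M) (D : Set (ℝ × ℝ)) (r s : ℝ × ℝ → ℝ) : Prop :=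
  ∀ x, T.state x ∈ D →
    T.dot (fun y ↦ r (T.state y)) x + r (T.state x) * divergence nabla T.u x = 0 ∧
    T.dot (fun y ↦ s (T.state y)) x = 0

/-- `T` represents the evolution in l.t.e. of a perfect fluid whose thermodynamic quantities `r`,
`s` satisfy `C`: around each state that occurs in the flow there are thermodynamic quantities,
functions of state, satisfying `C` and evolving along the flow of `T` at all events whose state is
in their domain. -/
def RepresentsLTE (nabla : AffineConnection M)
    (C : (ℝ × ℝ → ℝ) → (ℝ × ℝ → ℝ) → ℝ × ℝ → Prop) : Prop :=
  ∀ x, ∃ (D : Set (ℝ × ℝ)) (r s Θ : ℝ × ℝ → ℝ), T.state x ∈ D ∧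
    IsThermodynamics D r s Θ ∧ T.Evolves nabla D r s ∧ ∀ e ∈ D, C r s e

/-- The indicatrix is the function of state `χ`: `ṗ / ρ̇ = χ(ρ, p)` at every event, `χ` being a
smooth function on an open part of the thermodynamic plane that contains all states of the flow. -/
def IndicatrixEq (χ : ℝ × ℝ → ℝ) : Prop :=
  (∃ D : Set (ℝ × ℝ), IsOpen D ∧ Set.range T.state ⊆ D ∧ ContDiffOn ℝ ∞ χ D) ∧
    ∀ x, T.indicatrix x = χ (T.state x)

/-- Around each state of the flow, `T` can be endowed with thermodynamic quantities of positive
temperature that solve the equations for the given `χ`, and satisfy `C`. -/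
def CanBeEndowed (nabla : AffineConnection M) (χ : ℝ × ℝ → ℝ)
    (C : (ℝ × ℝ → ℝ) → (ℝ × ℝ → ℝ) → ℝ × ℝ → Prop) : Prop :=
  ∀ x, ∃ (D : Set (ℝ × ℝ)) (r s Θ : ℝ × ℝ → ℝ), T.state x ∈ D ∧
    IsThermodynamics D r s Θ ∧ (∀ e ∈ D, 0 < Θ e) ∧ T.Evolves nabla D r s ∧
    (∀ e ∈ D, SolvesSound χ r s e) ∧ ∀ e ∈ D, C r s e

end PerfectEnergyTensor

end

-- The state moves in the direction `(ρ̇, ṗ)`, so a function of state has `ż = ρ̇ dz(1, χ)`.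
-- Contracting `∇ · T = 0` with `u` gives `ρ̇ + (ρ + p) θ = 0`. Since `ρ̇ ≠ 0`, evolution in l.t.e.
-- means `dr(1, χ) = r / (ρ + p)` and `ds(1, χ) = 0` at the states that occur: two linear equations
-- in the plane, collected in `SoundOn`.
--
-- H₁ depends on `χ` alone. Indeed `τ = (ρ + p) / r²`, and `(1, χ)` is the direction of constant
-- `s`, so differentiating along it once and twice gives `(τ'_p)_s` and `(τ''_p)_s` as the two sides
-- of the inequalities for `χ`, up to positive factors (`SoundOn.condH1_iff`). Conversely,
-- thermodynamic quantities with `s'_ρ ≠ 0` give `χ = -s'_ρ / s'_p`, a smooth function on the set of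
-- states, which is open because `dρ ∧ dp ≠ 0` (`exists_indicatrixEq`).
--
-- For existence, straighten the field `(ρ + p)(1, χ)`: it has a time function `T` and a first
-- integral `S`, and `r = exp(T + kS)`, `s = -S` are solutions for every constant `k`. Choosing `k`
-- makes `(ρ + p) r'_ρ = c r` at the given state, with `c` arbitrary. There `s'_ρ > 0`, `Θ` has the
-- sign of `1 - c`, and `(τ'_s)_p` that of `1 - 2c`. So `c = 0` gives H₂ and `c = 3/4` gives H̄₂,
-- both with `Θ > 0` (`exists_soundOn`, `canBeEndowed`).
--
-- Straightening needs a flow that is smooth in time and initial point jointly. It comes from the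
-- inverse function theorem in the Banach space of continuous curves on `[-1, 1]`.

universe u

noncomputable section

/-! ### Smooth local inverses -/

/-- The inverse function theorem for maps that are smooth near a point, with a local inverse that
is smooth on a neighbourhood of the image. -/
theorem exists_smooth_localInverse {E F : Type*} [NormedAddCommGroup E] [NormedSpace ℝ E]
    [CompleteSpace E] [NormedAddCommGroup F] [NormedSpace ℝ F] {f : E → F} {a : E}
    (hf : ∀ᶠ x in 𝓝 a, ContDiffAt ℝ ∞ f x) (f' : E ≃L[ℝ] F)
    (hf' : HasFDerivAt f (f' : E →L[ℝ] F) a) :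
    ∃ g : F → E, g (f a) = a ∧ (∀ᶠ y in 𝓝 (f a), ContDiffAt ℝ ∞ g y ∧ f (g y) = y) ∧
      ∀ᶠ x in 𝓝 a, g (f x) = x := by
  have hfa : ContDiffAt ℝ ∞ f a := hf.self_of_nhds
  let e := hfa.toOpenPartialHomeomorph f hf' (by simp)
  have he : ∀ x, e x = f x := fun x ↦ rfl
  have ha : a ∈ e.source := hfa.mem_toOpenPartialHomeomorph_source hf' (by simp)
  have hga : e.symm (f a) = a := e.left_inv ha
  refine ⟨e.symm, hga, ?_, ?_⟩
  · have hfd : ContinuousAt (fderiv ℝ f) a := (hfa.fderiv_right (m := 0) (by simp)).continuousAt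
    -- Invertible operators form an open set, so the inverse is smooth at every point near `f a`.
    -- Smoothness of order `∞` at `f a` alone would give `C^n` only on neighbourhoods depending on
    -- `n`.
    have hequiv : ∀ᶠ x in 𝓝 a, fderiv ℝ f x ∈ Set.range ((↑) : (E ≃L[ℝ] F) → E →L[ℝ] F) := by
      apply hfd.eventually
      rw [hf'.fderiv]
      exact ContinuousLinearEquiv.nhds f'
    have hcont : Filter.Tendsto e.symm (𝓝 (f a)) (𝓝 a) := by
      have := e.tendsto_symm ha
      exact this
    filter_upwards [e.open_target.mem_nhds (e.map_source ha), hcont.eventually hequiv,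
      hcont.eventually hf] with y hy ⟨f₁, hf₁⟩ hfy
    refine ⟨e.contDiffAt_symm (f₀' := f₁) hy ?_ hfy, e.right_inv hy⟩
    rw [hf₁]
    exact (hfy.differentiableAt (by simp)).hasFDerivAt
  · filter_upwards [e.open_source.mem_nhds ha] with x hx using e.left_inv hx

/-! ### Smoothness of composition operators on spaces of continuous functions -/

section Nemytskii

variable {K F G : Type*} [TopologicalSpace K] [CompactSpace K]
  [NormedAddCommGroup F] [NormedSpace ℝ F] [NormedAddCommGroup G] [NormedSpace ℝ G]

/-- The pointwise application of an operator-valued continuous function, as a continuous bilinear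
map. -/
def ContinuousMap.pointwiseApply : C(K, F →L[ℝ] G) →L[ℝ] C(K, F) →L[ℝ] C(K, G) :=
  LinearMap.mkContinuous₂
    (LinearMap.mk₂ ℝ
      (fun (A : C(K, F →L[ℝ] G)) (φ : C(K, F)) ↦ (⟨fun t ↦ A t (φ t), by fun_prop⟩ : C(K, G)))
      (fun _ _ _ ↦ by ext; simp) (fun _ _ _ ↦ by ext; simp)
      (fun _ _ _ ↦ by ext; simp) (fun _ _ _ ↦ by ext; simp)) 1
    (fun A φ ↦ by
      rw [ContinuousMap.norm_le _ (by positivity)]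
      intro t
      rw [one_mul]
      exact ((A t).le_opNorm _).trans
        (by gcongr; exacts [A.norm_coe_le_norm t, φ.norm_coe_le_norm t]))

/-- Mean value inequality on the segment, where the derivative differs from its value at `x` by at
most `C ‖y - x‖`. The bound is uniform in `x`, hence passes to sup norms. -/
theorem norm_sub_sub_fderiv_le {V : F → G} {C : NNReal} (hV : Differentiable ℝ V)
    (hC : LipschitzWith C (fderiv ℝ V)) (x y : F) :
    ‖V y - V x - fderiv ℝ V x (y - x)‖ ≤ C * ‖y - x‖ ^ 2 := by
  have := (convex_segment (𝕜 := ℝ) x y).norm_image_sub_le_of_norm_fderiv_le' (f := V)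
    (φ := fderiv ℝ V x) (C := C * ‖y - x‖) (fun z _ ↦ hV z) (fun z hz ↦ ?_)
    (left_mem_segment ℝ x y) (right_mem_segment ℝ x y)
  · rw [pow_two, ← mul_assoc]; exact this
  · rw [← dist_eq_norm]
    refine (hC.dist_le_mul z x).trans ?_
    gcongr
    rw [dist_eq_norm]
    exact norm_sub_le_of_mem_segment hz

theorem hasFDerivAt_comp_continuousMap {V : F → G} (hV : ContDiff ℝ ∞ V) (hc : HasCompactSupport V)
    (φ : C(K, F)) :
    HasFDerivAt (fun ψ : C(K, F) ↦ (⟨V, hV.continuous⟩ : C(F, G)).comp ψ)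
      (ContinuousMap.pointwiseApply
        ((⟨fderiv ℝ V, hV.continuous_fderiv (by simp)⟩ : C(F, F →L[ℝ] G)).comp φ)) φ := by
  obtain ⟨C, hC⟩ := ContDiff.lipschitzWith_of_hasCompactSupport (𝕂 := ℝ) (n := ∞) (hc.fderiv ℝ)
    (hV.fderiv_right (by simp)) (by simp)
  rw [hasFDerivAt_iff_isLittleO]
  refine Asymptotics.IsBigO.trans_isLittleO (g := fun ψ ↦ ‖ψ - φ‖ ^ 2) ?_ ?_
  · refine Asymptotics.IsBigO.of_bound C (Filter.Eventually.of_forall fun ψ ↦ ?_)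
    rw [ContinuousMap.norm_le _ (by positivity)]
    intro t
    refine (norm_sub_sub_fderiv_le (hV.differentiable (by simp)) hC (φ t) (ψ t)).trans ?_
    rw [norm_pow, norm_norm]
    gcongr
    exact (ψ - φ).norm_coe_le_norm t
  · exact (Asymptotics.isLittleO_norm_pow_id (one_lt_two)).comp_tendsto (tendsto_sub_nhds_zero_iff.mpr
      Filter.tendsto_id)

end Nemytskii

/-- Composition with a smooth compactly supported map is a smooth operation on continuous
functions. -/
theorem contDiff_comp_continuousMap {K : Type*} [TopologicalSpace K] [CompactSpace K]
    {F G : Type u} [NormedAddCommGroup F] [NormedSpace ℝ F]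
    [NormedAddCommGroup G] [NormedSpace ℝ G] {V : F → G} (hV : ContDiff ℝ ∞ V)
    (hc : HasCompactSupport V) :
    ContDiff ℝ ∞ (fun ψ : C(K, F) ↦ (⟨V, hV.continuous⟩ : C(F, G)).comp ψ) := by
  rw [contDiff_infty]
  intro n
  induction n generalizing G with
  | zero =>
    refine contDiff_zero.mpr (continuous_iff_continuousAt.mpr fun φ ↦ ?_)
    exact (hasFDerivAt_comp_continuousMap hV hc φ).continuousAt
  | succ n ih =>
    push_cast
    -- The derivative is the composition operator of `fderiv ℝ V`, followed by a bounded linear map.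
    -- The induction hypothesis applies to it because `F →L[ℝ] G` lies in the universe of `G`.
    refine contDiff_succ_iff_hasFDerivAt.mpr ⟨_, ?_, hasFDerivAt_comp_continuousMap hV hc⟩
    exact ContinuousMap.pointwiseApply.contDiff.comp
      (ih (hV.fderiv_right (m := ∞) (by simp)) (hc.fderiv ℝ))

/-! ### Smooth local flows -/

theorem neg_one_le_one_real : (-1 : ℝ) ≤ 1 := by norm_num

section Flow

variable {F : Type u} [NormedAddCommGroup F] [NormedSpace ℝ F]

/-- The primitive, vanishing at `0`, of a continuous function on `[-1, 1]`. -/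
def primitiveCLM [CompleteSpace F] : C(Set.Icc (-1 : ℝ) 1, F) →L[ℝ] C(Set.Icc (-1 : ℝ) 1, F) :=
  LinearMap.mkContinuous
    { toFun := fun u ↦ ⟨fun t ↦ ∫ σ in (0 : ℝ)..t, Set.IccExtend neg_one_le_one_real u σ,
        (intervalIntegral.continuous_primitive
          (fun _ _ ↦ (u.continuous.Icc_extend' (h := neg_one_le_one_real)).intervalIntegrable _ _) 0).comp
          continuous_subtype_val⟩
      map_add' := fun u v ↦ by
        ext t
        exact intervalIntegral.integral_add
          ((u.continuous.Icc_extend' (h := neg_one_le_one_real)).intervalIntegrable _ _)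
          ((v.continuous.Icc_extend' (h := neg_one_le_one_real)).intervalIntegrable _ _)
      map_smul' := fun c u ↦ by
        ext t
        exact intervalIntegral.integral_smul c _ } 1
    (fun u ↦ by
      rw [ContinuousMap.norm_le _ (by positivity)]
      intro t
      have h := intervalIntegral.norm_integral_le_of_norm_le_const (a := 0) (b := (t : ℝ))
        (f := Set.IccExtend neg_one_le_one_real u) (C := ‖u‖) (fun σ _ ↦ u.norm_coe_le_norm _)
      refine h.trans ?_
      have ht : |(t : ℝ) - 0| ≤ 1 := by rw [sub_zero]; exact abs_le.mpr t.2
      rw [one_mul]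
      exact mul_le_of_le_one_right (norm_nonneg _) ht)

theorem primitiveCLM_apply [CompleteSpace F] (u : C(Set.Icc (-1 : ℝ) 1, F))
    (t : Set.Icc (-1 : ℝ) 1) :
    primitiveCLM u t = ∫ σ in (0 : ℝ)..t, Set.IccExtend neg_one_le_one_real u σ := rfl

theorem norm_primitiveCLM_le [CompleteSpace F] (u : C(Set.Icc (-1 : ℝ) 1, F)) :
    ‖primitiveCLM u‖ ≤ ‖u‖ := by
  simpa using (primitiveCLM (F := F)).le_of_opNorm_le
    (LinearMap.mkContinuous_norm_le _ zero_le_one _) u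

/-- Constant functions on `[-1, 1]`. -/
def constCLM : F →L[ℝ] C(Set.Icc (-1 : ℝ) 1, F) :=
  LinearMap.mkContinuous
    { toFun := fun y ↦ ContinuousMap.const _ y
      map_add' := fun _ _ ↦ rfl
      map_smul' := fun _ _ ↦ rfl } 1
    (fun y ↦ by
      rw [ContinuousMap.norm_le _ (by positivity)]
      intro t
      exact (one_mul _).ge)

theorem constCLM_apply (y : F) (t : Set.Icc (-1 : ℝ) 1) : constCLM y t = y := rfl

/-- The integral equation of the rescaled orbits `τ ↦ x(ετ)`, `x' = V(x)`, `x(0) = y`. -/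
def IsRescaledOrbit [CompleteSpace F] (V : C(F, F)) (ε : ℝ) (y : F)
    (φ : C(Set.Icc (-1 : ℝ) 1, F)) : Prop :=
  φ = constCLM y + ε • primitiveCLM (V.comp φ)

/-- For `|ε| C < 1` the right-hand side of the integral equation is a contraction in the sup norm.
-/
theorem IsRescaledOrbit.unique [CompleteSpace F] {V : C(F, F)} {C : NNReal}
    (hV : LipschitzWith C V) {ε : ℝ} {y : F}
    (hε : |ε| * C < 1) {φ ψ : C(Set.Icc (-1 : ℝ) 1, F)} (hφ : IsRescaledOrbit V ε y φ)
    (hψ : IsRescaledOrbit V ε y ψ) : φ = ψ := by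
  have h1 : ‖V.comp φ - V.comp ψ‖ ≤ C * ‖φ - ψ‖ := by
    rw [ContinuousMap.norm_le _ (by positivity)]
    intro t
    refine (hV.norm_sub_le (φ t) (ψ t)).trans ?_
    gcongr
    exact (φ - ψ).norm_coe_le_norm t
  have h2 : φ - ψ = ε • primitiveCLM (V.comp φ - V.comp ψ) := by
    rw [map_sub, smul_sub]
    nth_rewrite 1 [hφ, hψ]
    abel
  have h3 : ‖φ - ψ‖ ≤ |ε| * (C * ‖φ - ψ‖) := by
    nth_rewrite 1 [h2]
    rw [norm_smul, Real.norm_eq_abs]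
    gcongr
    exact (norm_primitiveCLM_le _).trans h1
  have h4 : ‖φ - ψ‖ = 0 := by
    have := norm_nonneg (φ - ψ)
    nlinarith
  exact sub_eq_zero.mp (norm_eq_zero.mp h4)

theorem IsRescaledOrbit.apply [CompleteSpace F] {V : C(F, F)} {ε : ℝ} {y : F}
    {φ : C(Set.Icc (-1 : ℝ) 1, F)} (hφ : IsRescaledOrbit V ε y φ) {t : ℝ}
    (ht : t ∈ Set.Icc (-1 : ℝ) 1) :
    Set.IccExtend neg_one_le_one_real φ t =
      y + ε • ∫ σ in (0 : ℝ)..t, V (Set.IccExtend neg_one_le_one_real φ σ) := by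
  rw [Set.IccExtend_of_mem _ _ ht]
  nth_rewrite 1 [hφ]
  rfl

/-- Rescaling the time of an orbit. -/
theorem IsRescaledOrbit.rescale [CompleteSpace F] {V : C(F, F)} {ε : ℝ} {y : F}
    {φ : C(Set.Icc (-1 : ℝ) 1, F)} (hφ : IsRescaledOrbit V ε y φ) {c : ℝ} (hc : |c| ≤ 1) :
    IsRescaledOrbit V (c * ε) y
      ⟨fun t ↦ Set.IccExtend neg_one_le_one_real φ (c * t),
        (φ.continuous.Icc_extend' (h := neg_one_le_one_real)).comp
          (continuous_const.mul continuous_subtype_val)⟩ := by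
  have hmem : ∀ t ∈ Set.Icc (-1 : ℝ) 1, c * t ∈ Set.Icc (-1 : ℝ) 1 := fun t ht ↦ by
    rw [Set.mem_Icc, ← abs_le] at ht ⊢
    rw [abs_mul]
    exact mul_le_one₀ hc (abs_nonneg _) ht
  unfold IsRescaledOrbit
  ext t
  simp only [ContinuousMap.coe_mk, ContinuousMap.add_apply, ContinuousMap.smul_apply,
    constCLM_apply, primitiveCLM_apply]
  rw [hφ.apply (hmem t t.2), mul_comm c ε, mul_smul]
  congr 2
  have h := intervalIntegral.smul_integral_comp_mul_left (a := 0) (b := (t : ℝ))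
    (fun σ ↦ V (Set.IccExtend neg_one_le_one_real φ σ)) c
  rw [mul_zero] at h
  rw [← h]
  congr 1
  refine intervalIntegral.integral_congr fun σ hσ ↦ ?_
  have hσ' : σ ∈ Set.Icc (-1 : ℝ) 1 :=
    Set.uIcc_subset_Icc (by norm_num) t.2 hσ
  simp [Set.IccExtend_of_mem _ _ hσ']

/-- Local flows of smooth compactly supported vector fields are smooth. -/
theorem exists_smooth_flow [CompleteSpace F] [FiniteDimensional ℝ F] {V : F → F}
    (hV : ContDiff ℝ ∞ V) (hc : HasCompactSupport V) (x₀ : F) :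
    ∃ Φ : ℝ × F → F, (∀ᶠ z in 𝓝 ((0 : ℝ), x₀), ContDiffAt ℝ ∞ Φ z) ∧
      ∀ᶠ z in 𝓝 ((0 : ℝ), x₀), Φ (0, z.2) = z.2 ∧
        HasDerivAt (fun t ↦ Φ (t, z.2)) (V (Φ z)) z.1 := by
  obtain ⟨C, hC⟩ := ContDiff.lipschitzWith_of_hasCompactSupport (𝕂 := ℝ) hc hV (by simp)
  let W : C(F, F) := ⟨V, hV.continuous⟩
  let N : C(Set.Icc (-1 : ℝ) 1, F) → C(Set.Icc (-1 : ℝ) 1, F) := fun φ ↦ W.comp φ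
  have hN : ContDiff ℝ ∞ N := contDiff_comp_continuousMap hV hc
  have hJN : ContDiff ℝ ∞ (fun φ ↦ primitiveCLM (N φ)) :=
    (primitiveCLM (F := F)).contDiff.comp hN
  -- Orbits are the zeros of the second component. Keeping `(ε, y)` as the first component reduces
  -- the implicit function theorem to the inverse one.
  let f : (ℝ × F) × C(Set.Icc (-1 : ℝ) 1, F) → (ℝ × F) × C(Set.Icc (-1 : ℝ) 1, F) :=
    fun q ↦ (q.1, q.2 - (constCLM q.1.2 + q.1.1 • primitiveCLM (N q.2)))
  have hf : ContDiff ℝ ∞ f := by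
    refine contDiff_fst.prodMk (contDiff_snd.sub (ContDiff.add ?_ (ContDiff.fun_smul ?_ ?_)))
    · exact (constCLM (F := F)).contDiff.comp (contDiff_snd.comp contDiff_fst)
    · exact contDiff_fst.comp contDiff_fst
    · exact hJN.comp contDiff_snd
  let a : (ℝ × F) × C(Set.Icc (-1 : ℝ) 1, F) := ((0, x₀), constCLM x₀)
  have hfa : f a = ((0, x₀), 0) := by simp [f, a]
  let A : ℝ × F →L[ℝ] C(Set.Icc (-1 : ℝ) 1, F) :=
    constCLM.comp (ContinuousLinearMap.snd ℝ ℝ F) +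
      (ContinuousLinearMap.fst ℝ ℝ F).smulRight (primitiveCLM (N (constCLM x₀)))
  let p₁ := ContinuousLinearMap.fst ℝ (ℝ × F) C(Set.Icc (-1 : ℝ) 1, F)
  let p₂ := ContinuousLinearMap.snd ℝ (ℝ × F) C(Set.Icc (-1 : ℝ) 1, F)
  -- At `ε = 0` the nonlinear term has no derivative in the curve, so the total derivative is a
  -- shear, with explicit inverse.
  let f' : ((ℝ × F) × C(Set.Icc (-1 : ℝ) 1, F)) ≃L[ℝ] (ℝ × F) × C(Set.Icc (-1 : ℝ) 1, F) :=
    ContinuousLinearEquiv.equivOfInverse (p₁.prod (p₂ - A.comp p₁)) (p₁.prod (p₂ + A.comp p₁))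
      (fun q ↦ by ext1 <;> simp [p₁, p₂]) (fun q ↦ by ext1 <;> simp [p₁, p₂])
  have hf' : HasFDerivAt f (f' : _ →L[ℝ] _) a := by
    have h1 : HasFDerivAt
        (fun q : (ℝ × F) × C(Set.Icc (-1 : ℝ) 1, F) ↦ q.1.1 • primitiveCLM (N q.2)) _ a :=
      ((ContinuousLinearMap.fst ℝ ℝ F).comp p₁).hasFDerivAt.smul
        (((hJN.differentiable (by simp)).differentiableAt).hasFDerivAt.comp a p₂.hasFDerivAt)
    have h2 := (constCLM.comp ((ContinuousLinearMap.snd ℝ ℝ F).comp p₁)).hasFDerivAt (x := a)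
    refine (p₁.hasFDerivAt.prodMk (p₂.hasFDerivAt.sub (h2.add h1))).congr_fderiv ?_
    ext1 <;> ext q <;> simp [f', A, p₁, p₂, a]
  obtain ⟨g, hga, hg, -⟩ := exists_smooth_localInverse
    (Filter.Eventually.of_forall fun x ↦ hf.contDiffAt) f' hf'
  rw [hfa] at hga hg
  have hι : ContDiff ℝ ∞ (fun z : ℝ × F ↦ (z, (0 : C(Set.Icc (-1 : ℝ) 1, F)))) := by fun_prop
  have hg' := (hι.continuous.tendsto (0, x₀)).eventually hg
  let φ : ℝ × F → C(Set.Icc (-1 : ℝ) 1, F) := fun z ↦ (g (z, 0)).2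
  have hφs : ∀ᶠ z in 𝓝 ((0 : ℝ), x₀), ContDiffAt ℝ ∞ φ z := by
    filter_upwards [hg'] with z hz
    exact contDiffAt_snd.comp z (hz.1.comp z hι.contDiffAt)
  have hφ : ∀ᶠ z in 𝓝 ((0 : ℝ), x₀), IsRescaledOrbit W z.1 z.2 (φ z) := by
    filter_upwards [hg'] with z hz
    have h1 : (g (z, 0)).1 = z := congrArg Prod.fst hz.2
    have h2 := congrArg Prod.snd hz.2
    simp only [f, h1, sub_eq_zero] at h2
    exact h2
  let one : Set.Icc (-1 : ℝ) 1 := ⟨1, by norm_num⟩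
  refine ⟨fun z ↦ φ z one, ?_, ?_⟩
  · filter_upwards [hφs] with z hz
    exact (ContinuousMap.evalCLM ℝ one).contDiff.contDiffAt.comp z hz
  · have hsmall : ∀ᶠ z in 𝓝 ((0 : ℝ), x₀), |z.1| * (C : ℝ) < 1 := by
      have : Filter.Tendsto (fun z : ℝ × F ↦ |z.1| * (C : ℝ)) (𝓝 (0, x₀)) (𝓝 (|(0 : ℝ)| * (C : ℝ))) :=
        (by fun_prop : Continuous fun z : ℝ × F ↦ |z.1| * (C : ℝ)).tendsto _
      exact this.eventually_lt_const (by simp)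
    obtain ⟨δ, hδ, hball⟩ := Metric.eventually_nhds_iff_ball.mp (hφ.and hsmall)
    filter_upwards [Metric.ball_mem_nhds _ hδ] with z hz
    rw [← ball_prod_same, Set.mem_prod, mem_ball_zero_iff, Real.norm_eq_abs] at hz
    -- By uniqueness, every `φ (t, y)` with `|t| ≤ η` is a rescaling of the single curve `u = φ (η,
    -- y)`. Hence the flow at time `t` is `u (t / η)`, and the differential equation follows from
    -- the fundamental theorem of calculus.
    obtain ⟨η, hη, hηδ⟩ := exists_between hz.1
    have hη0 : 0 < η := (abs_nonneg _).trans_lt hη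
    have hbox : ∀ t, |t| ≤ η → IsRescaledOrbit W t z.2 (φ (t, z.2)) ∧ |t| * (C : ℝ) < 1 := by
      intro t ht
      refine hball (t, z.2) ?_
      rw [← ball_prod_same, Set.mem_prod, mem_ball_zero_iff, Real.norm_eq_abs]
      exact ⟨ht.trans_lt hηδ, hz.2⟩
    have hu := (hbox η (abs_of_pos hη0).le).1
    set u := φ (η, z.2) with hu_def
    have hval : ∀ t, |t| ≤ η → φ (t, z.2) one = Set.IccExtend neg_one_le_one_real u (t / η) := by
      intro t ht
      have h1 := hu.rescale (c := t / η) (by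
        rw [abs_div, abs_of_pos hη0]; exact div_le_one_of_le₀ ht hη0.le)
      rw [div_mul_cancel₀ _ hη0.ne'] at h1
      rw [(hbox t ht).1.unique hC (hbox t ht).2 h1]
      simp [one]
    have hcont : Continuous fun σ ↦ W (Set.IccExtend neg_one_le_one_real u σ) :=
      W.continuous.comp (u.continuous.Icc_extend' (h := neg_one_le_one_real))
    have hval' : ∀ t, |t| ≤ η → φ (t, z.2) one = z.2 +
        η • ∫ σ in (0 : ℝ)..(t / η), W (Set.IccExtend neg_one_le_one_real u σ) := by
      intro t ht
      rw [hval t ht, hu.apply]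
      rw [Set.mem_Icc, ← abs_le, abs_div, abs_of_pos hη0]
      exact div_le_one_of_le₀ ht hη0.le
    constructor
    · rw [hval' 0 (by simpa using hη0.le)]
      simp
    · have hd : HasDerivAt (fun t ↦ z.2 +
          η • ∫ σ in (0 : ℝ)..(t / η), W (Set.IccExtend neg_one_le_one_real u σ))
          (V (φ z one)) z.1 := by
        have h1 := intervalIntegral.integral_hasDerivAt_right
          (hcont.intervalIntegrable 0 (z.1 / η)) (hcont.stronglyMeasurableAtFilter _ _)
          hcont.continuousAt
        have h2 := (h1.scomp z.1 ((hasDerivAt_id z.1).div_const η)).const_smul η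
        refine (h2.const_add z.2).congr_deriv ?_
        rw [smul_smul, mul_one_div_cancel hη0.ne', one_smul, ← hval z.1 hη.le]
        rfl
      refine hd.congr_of_eventuallyEq ?_
      have : ∀ᶠ t in 𝓝 z.1, |t| < η := continuous_abs.continuousAt.eventually_lt_const hη
      filter_upwards [this] with t ht using hval' t ht.le

end Flow

/-! ### Rectification of vector fields of the plane -/

theorem exists_contDiff_hasCompactSupport_eventuallyEq {E F : Type*} [NormedAddCommGroup E]
    [NormedSpace ℝ E] [FiniteDimensional ℝ E] [NormedAddCommGroup F] [NormedSpace ℝ F]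
    {V : E → F} {a : E} (hV : ∀ᶠ x in 𝓝 a, ContDiffAt ℝ ∞ V x) :
    ∃ W : E → F, ContDiff ℝ ∞ W ∧ HasCompactSupport W ∧ ∀ᶠ x in 𝓝 a, W x = V x := by
  obtain ⟨δ, hδ, hball⟩ := Metric.eventually_nhds_iff_ball.mp hV
  let β : ContDiffBump a := ⟨δ / 3, δ / 2, by positivity, by linarith⟩
  refine ⟨fun x ↦ β x • V x, contDiff_iff_contDiffAt.mpr fun x ↦ ?_,
    β.hasCompactSupport.smul_right, ?_⟩
  · by_cases hx : x ∈ Metric.ball a δ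
    · exact β.contDiff.contDiffAt.smul (hball x hx)
    · have hx' : x ∈ (tsupport β)ᶜ := by
        rw [β.tsupport_eq, Set.mem_compl_iff, Metric.mem_closedBall, not_le]
        rw [Metric.mem_ball, not_lt] at hx
        change δ / 2 < _
        linarith
      have h0 : (fun x ↦ β x • V x) =ᶠ[𝓝 x] fun _ ↦ 0 := by
        filter_upwards [(isClosed_tsupport β).isOpen_compl.mem_nhds hx'] with z hz
        rw [image_eq_zero_of_notMem_tsupport hz, zero_smul]
      exact contDiffAt_const.congr_of_eventuallyEq h0
  · filter_upwards [β.eventuallyEq_one] with x hx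
    rw [hx, Pi.one_apply, one_smul]

/-- Rectification of a smooth vector field of the plane: near a point where its first component
does not vanish, it has a time function `T` and a first integral `S`. -/
theorem exists_time_firstIntegral {V : ℝ × ℝ → ℝ × ℝ} {e₀ : ℝ × ℝ}
    (hV : ∀ᶠ e in 𝓝 e₀, ContDiffAt ℝ ∞ V e) (hV₀ : (V e₀).1 ≠ 0) :
    ∃ T S : ℝ × ℝ → ℝ, (∀ᶠ e in 𝓝 e₀, ContDiffAt ℝ ∞ T e ∧ ContDiffAt ℝ ∞ S e ∧
      fderiv ℝ T e (V e) = 1 ∧ fderiv ℝ S e (V e) = 0) ∧ fderiv ℝ S e₀ (0, 1) = 1 := by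
  obtain ⟨W, hW, hWc, hWV⟩ := exists_contDiff_hasCompactSupport_eventuallyEq hV
  obtain ⟨Φ, hΦ, hΦd⟩ := exists_smooth_flow hW hWc e₀
  -- Flow out of the vertical line through `e₀`, which is transverse to `V` since `(V e₀).1 ≠ 0`.
  let j : ℝ × ℝ → ℝ × (ℝ × ℝ) := fun q ↦ (q.1, e₀ + (0, q.2))
  have hj : ContDiff ℝ ∞ j := by fun_prop
  have hj0 : j 0 = (0, e₀) := by simp [j]
  have hjt : Filter.Tendsto j (𝓝 0) (𝓝 (0, e₀)) := hj0 ▸ hj.continuous.tendsto 0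
  let Ψ : ℝ × ℝ → ℝ × ℝ := fun q ↦ Φ (j q)
  have hΨ : ∀ᶠ q in 𝓝 0, ContDiffAt ℝ ∞ Ψ q := by
    filter_upwards [hjt.eventually hΦ] with q hq using hq.comp q hj.contDiffAt
  have hΨd : ∀ᶠ q in 𝓝 0, fderiv ℝ Ψ q (1, 0) = W (Ψ q) := by
    filter_upwards [hΨ, hjt.eventually hΦd] with q hq hqd
    have h1 : HasDerivAt (fun t : ℝ ↦ (t, q.2)) ((1 : ℝ), (0 : ℝ)) q.1 :=
      (hasDerivAt_id q.1).prodMk (hasDerivAt_const q.1 q.2)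
    have h2 := (hq.differentiableAt (by simp)).hasFDerivAt.comp_hasDerivAt q.1 h1
    exact h2.unique hqd.2
  have hΨ00 : ∀ᶠ y in 𝓝 (0 : ℝ), Ψ (0, y) = e₀ + (0, y) := by
    have hc : Filter.Tendsto (fun y : ℝ ↦ ((0 : ℝ), y)) (𝓝 0) (𝓝 0) :=
      (by fun_prop : Continuous fun y : ℝ ↦ ((0 : ℝ), y)).tendsto 0
    filter_upwards [hc.eventually (hjt.eventually hΦd)] with y hy using hy.1
  have hΨ0 : Ψ 0 = e₀ := by
    have := hΨ00.self_of_nhds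
    rwa [Prod.mk_zero_zero, add_zero] at this
  have hD0 := (hΨ.self_of_nhds.differentiableAt (by simp)).hasFDerivAt
  have hD1 : fderiv ℝ Ψ 0 (1, 0) = V e₀ := by
    rw [hΨd.self_of_nhds, hΨ0, hWV.self_of_nhds]
  have hD2 : fderiv ℝ Ψ 0 (0, 1) = (0, 1) := by
    have h1 : HasDerivAt (fun y : ℝ ↦ ((0 : ℝ), y)) ((0 : ℝ), (1 : ℝ)) 0 :=
      (hasDerivAt_const 0 (0 : ℝ)).prodMk (hasDerivAt_id 0)
    have h2 := hD0.comp_hasDerivAt (0 : ℝ) h1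
    have h3 : HasDerivAt (fun y : ℝ ↦ e₀ + ((0 : ℝ), y)) ((0 : ℝ), (1 : ℝ)) 0 := h1.const_add e₀
    exact h2.unique (h3.congr_of_eventuallyEq hΨ00)
  have hD : ∀ q : ℝ × ℝ, fderiv ℝ Ψ 0 q = (q.1 * (V e₀).1, q.1 * (V e₀).2 + q.2) := by
    intro q
    have h1 : q = q.1 • ((1 : ℝ), (0 : ℝ)) + q.2 • ((0 : ℝ), (1 : ℝ)) := by ext <;> simp
    rw [h1, map_add, map_smul, map_smul, hD1, hD2]
    ext <;> simp
  let B : ℝ × ℝ →L[ℝ] ℝ × ℝ :=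
    (((V e₀).1)⁻¹ • ContinuousLinearMap.fst ℝ ℝ ℝ).prod
      (ContinuousLinearMap.snd ℝ ℝ ℝ - ((V e₀).2 * ((V e₀).1)⁻¹) • ContinuousLinearMap.fst ℝ ℝ ℝ)
  have hB : ∀ q : ℝ × ℝ, B q = ((V e₀).1⁻¹ * q.1, q.2 - (V e₀).2 * (V e₀).1⁻¹ * q.1) :=
    fun q ↦ rfl
  let D : (ℝ × ℝ) ≃L[ℝ] ℝ × ℝ := ContinuousLinearEquiv.equivOfInverse (fderiv ℝ Ψ 0) B
    (fun q ↦ by rw [hD, hB]; ext <;> dsimp only <;> field_simp; ring)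
    (fun q ↦ by rw [hB, hD]; ext <;> dsimp only <;> field_simp; ring)
  obtain ⟨g, hg0, hg, hgΨ⟩ := exists_smooth_localInverse hΨ D hD0
  rw [hΨ0] at hg0 hg
  have hgc : Filter.Tendsto g (𝓝 e₀) (𝓝 0) := by
    have := hg.self_of_nhds.1.continuousAt.tendsto
    rwa [hg0] at this
  have hinv : ∀ᶠ e in 𝓝 e₀, ∀ v, fderiv ℝ g e (fderiv ℝ Ψ (g e) v) = v := by
    filter_upwards [hgc.eventually hgΨ.eventually_nhds, hgc.eventually hΨ, hg] with e h1 h2 h3 v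
    have h4 : HasFDerivAt (fun q ↦ g (Ψ q)) _ (g e) :=
      HasFDerivAt.comp (g e) (g := g) (h3.2.symm ▸ (h3.1.differentiableAt (by simp))).hasFDerivAt
        (h2.differentiableAt (by simp)).hasFDerivAt
    have h5 := h4.unique ((hasFDerivAt_id (g e)).congr_of_eventuallyEq h1)
    have h6 := congrArg (fun A ↦ A v) h5
    simpa [h3.2] using h6
  -- The flow coordinates serve: `dΨ(1, 0) = V` near the centre, so the inverse `g` satisfies `dg(V)
  -- = (1, 0)`.
  refine ⟨fun e ↦ (g e).1, fun e ↦ (g e).2, ?_, ?_⟩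
  · filter_upwards [hg, hinv, hgc.eventually hΨd, hWV] with e h1 h2 h3 h4
    have h5 := h2 (1, 0)
    rw [h3, h1.2, h4] at h5
    have h6 := (h1.1.differentiableAt (by simp)).hasFDerivAt
    refine ⟨h1.1.fst, h1.1.snd, ?_, ?_⟩
    · rw [h6.fst.fderiv]; exact congrArg Prod.fst h5
    · rw [h6.snd.fderiv]; exact congrArg Prod.snd h5
  · have h1 := hinv.self_of_nhds (0, 1)
    rw [hg0, hD2] at h1
    rw [(hg.self_of_nhds.1.differentiableAt (by simp)).hasFDerivAt.snd.fderiv]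
    exact congrArg Prod.snd h1

/-! ### The sound equations and the derivatives of the dynamic volume -/

theorem partialRho_eq_fderiv {z : ℝ × ℝ → ℝ} {e : ℝ × ℝ} (hz : DifferentiableAt ℝ z e) :
    partialRho z e = fderiv ℝ z e (1, 0) :=
  (hz.hasFDerivAt.comp_hasDerivAt e.1
    ((hasDerivAt_id e.1).prodMk (hasDerivAt_const e.1 e.2))).deriv

theorem partialP_eq_fderiv {z : ℝ × ℝ → ℝ} {e : ℝ × ℝ} (hz : DifferentiableAt ℝ z e) :
    partialP z e = fderiv ℝ z e (0, 1) :=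
  (hz.hasFDerivAt.comp_hasDerivAt e.2
    ((hasDerivAt_const e.2 e.1).prodMk (hasDerivAt_id e.2))).deriv

theorem map_one_mk (A : ℝ × ℝ →L[ℝ] ℝ) (c : ℝ) : A (1, c) = A (1, 0) + c * A (0, 1) := by
  have h : ((1 : ℝ), c) = (1, 0) + c • ((0 : ℝ), (1 : ℝ)) := by ext <;> simp
  rw [h, map_add, map_smul, smul_eq_mul]

/-- On the open set `U` of states, `r` and `s` solve the equations of matter conservation and of
local adiabaticity for the indicatrix `χ`. -/
structure SoundOn (χ r s : ℝ × ℝ → ℝ) (U : Set (ℝ × ℝ)) : Prop where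
  isOpen : IsOpen U
  r_smooth : ∀ e ∈ U, ContDiffAt ℝ ∞ r e
  s_smooth : ∀ e ∈ U, ContDiffAt ℝ ∞ s e
  χ_smooth : ∀ e ∈ U, ContDiffAt ℝ ∞ χ e
  pos : ∀ e ∈ U, 0 < e.1 + e.2
  r_pos : ∀ e ∈ U, 0 < r e
  χ_ne : ∀ e ∈ U, χ e ≠ 0
  r_eq : ∀ e ∈ U, fderiv ℝ r e (1, χ e) = r e / (e.1 + e.2)
  s_eq : ∀ e ∈ U, fderiv ℝ s e (1, χ e) = 0

theorem fderiv_of_eventuallyEq_comp {s z zhat : ℝ × ℝ → ℝ} {e : ℝ × ℝ}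
    (hs : DifferentiableAt ℝ s e) (hz : DifferentiableAt ℝ zhat (s e, e.2))
    (h : ∀ᶠ e' in 𝓝 e, z e' = zhat (s e', e'.2)) (v : ℝ × ℝ) :
    fderiv ℝ z e v = fderiv ℝ zhat (s e, e.2) (fderiv ℝ s e v, v.2) := by
  have h1 : HasFDerivAt (fun e' ↦ zhat (s e', e'.2)) _ e :=
    HasFDerivAt.comp e (g := zhat) hz.hasFDerivAt (hs.hasFDerivAt.prodMk hasFDerivAt_snd)
  rw [(h1.congr_of_eventuallyEq h).fderiv]
  rfl

theorem dynamicVolume_eq (r : ℝ × ℝ → ℝ) (e : ℝ × ℝ) :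
    dynamicVolume r e = (e.1 + e.2) / r e ^ 2 := by
  simp only [dynamicVolume, enthalpy, internalEnergy, specificVolume]
  ring

theorem hasLineDerivAt_dynamicVolume {r : ℝ × ℝ → ℝ} {e : ℝ × ℝ} (hr : DifferentiableAt ℝ r e)
    (h0 : r e ≠ 0) (v : ℝ × ℝ) :
    HasLineDerivAt ℝ (dynamicVolume r)
      ((v.1 + v.2) / r e ^ 2 - 2 * (e.1 + e.2) * fderiv ℝ r e v / r e ^ 3) e v := by
  have h1 : HasDerivAt (fun t : ℝ ↦ r (e + t • v)) (fderiv ℝ r e v) 0 :=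
    hr.hasFDerivAt.hasLineDerivAt v
  have h2 : HasDerivAt (fun t : ℝ ↦ (e + t • v).1 + (e + t • v).2) (v.1 + v.2) 0 := by
    have h3 : HasDerivAt (fun t : ℝ ↦ (e.1 + t * v.1) + (e.2 + t * v.2)) (1 * v.1 + 1 * v.2) 0 :=
      (((hasDerivAt_id (0 : ℝ)).mul_const v.1).const_add e.1).add
        (((hasDerivAt_id (0 : ℝ)).mul_const v.2).const_add e.2)
    simpa using h3
  unfold HasLineDerivAt
  simp only [dynamicVolume_eq]
  refine (h2.fun_div (h1.fun_pow 2) (by simpa using h0)).congr_deriv ?_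
  simp only [zero_smul, add_zero]
  field_simp
  ring

theorem differentiableAt_dynamicVolume {r : ℝ × ℝ → ℝ} {e : ℝ × ℝ} (hr : DifferentiableAt ℝ r e)
    (h0 : r e ≠ 0) : DifferentiableAt ℝ (dynamicVolume r) e := by
  have : dynamicVolume r = fun e ↦ (e.1 + e.2) / r e ^ 2 := funext (dynamicVolume_eq r)
  rw [this]
  fun_prop (disch := exact pow_ne_zero 2 h0)

theorem fderiv_dynamicVolume {r : ℝ × ℝ → ℝ} {e : ℝ × ℝ} (hr : DifferentiableAt ℝ r e)
    (h0 : r e ≠ 0) (v : ℝ × ℝ) :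
    fderiv ℝ (dynamicVolume r) e v =
      (v.1 + v.2) / r e ^ 2 - 2 * (e.1 + e.2) * fderiv ℝ r e v / r e ^ 3 :=
  ((differentiableAt_dynamicVolume hr h0).hasFDerivAt.hasLineDerivAt v).lineDeriv.symm.trans
    (hasLineDerivAt_dynamicVolume hr h0 v).lineDeriv

namespace SoundOn

variable {χ r s : ℝ × ℝ → ℝ} {U : Set (ℝ × ℝ)} (h : SoundOn χ r s U)
include h

/-- The equation for `r` turns the second term of the general formula into `-2 / r²`, which is added
to `(1 + χ) / r²`. -/
theorem fderiv_dynamicVolume {e : ℝ × ℝ} (he : e ∈ U) :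
    fderiv ℝ (dynamicVolume r) e (1, χ e) = (χ e - 1) / r e ^ 2 := by
  have hr := (h.r_pos e he).ne'
  have hw := (h.pos e he).ne'
  rw [_root_.fderiv_dynamicVolume ((h.r_smooth e he).differentiableAt (by simp)) hr, h.r_eq e he]
  field_simp
  ring

/-- `(τ'_p)_s = (χ - 1) / (χ r²)`. -/
theorem fderiv_expressed {τ : ℝ × ℝ → ℝ} {e : ℝ × ℝ} (he : e ∈ U)
    (hτ : DifferentiableAt ℝ τ (s e, e.2))
    (heq : ∀ᶠ e' in 𝓝 e, dynamicVolume r e' = τ (s e', e'.2)) :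
    fderiv ℝ τ (s e, e.2) (0, 1) = (χ e - 1) / (χ e * r e ^ 2) := by
  -- In the coordinates `(s, p)` the vector `(1, χ)` becomes `(0, χ)`.
  have h1 := fderiv_of_eventuallyEq_comp ((h.s_smooth e he).differentiableAt (by simp)) hτ heq
    (1, χ e)
  rw [h.s_eq e he, h.fderiv_dynamicVolume he] at h1
  have h2 : ((0 : ℝ), χ e) = χ e • ((0 : ℝ), (1 : ℝ)) := by ext <;> simp
  simp only [h2, map_smul, smul_eq_mul] at h1
  have hr := (h.r_pos e he).ne'
  have hχ := h.χ_ne e he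
  field_simp at h1 ⊢
  linarith

theorem deriv_expressed {τ : ℝ × ℝ → ℝ} {e : ℝ × ℝ} (he : e ∈ U)
    (hτ : IsExpressedBy s (dynamicVolume r) τ e) :
    deriv (fun b ↦ τ (s e, b)) e.2 = (χ e - 1) / (χ e * r e ^ 2) := by
  have hd := hτ.smooth.differentiableAt (by simp)
  exact (partialP_eq_fderiv hd).trans (h.fderiv_expressed he hd hτ.eq)

theorem fderiv_slope {e : ℝ × ℝ} (he : e ∈ U) :
    fderiv ℝ (fun e ↦ (χ e - 1) / (χ e * r e ^ 2)) e (1, χ e) =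
      ((e.1 + e.2) * fderiv ℝ χ e (1, χ e) + 2 * χ e * (1 - χ e)) /
        (χ e ^ 2 * r e ^ 2 * (e.1 + e.2)) := by
  have hr := (h.r_pos e he).ne'
  have hw := (h.pos e he).ne'
  have hχ := h.χ_ne e he
  have h1 := ((h.r_smooth e he).differentiableAt (by simp)).hasFDerivAt.hasLineDerivAt (1, χ e)
  have h2 := ((h.χ_smooth e he).differentiableAt (by simp)).hasFDerivAt.hasLineDerivAt (1, χ e)
  rw [h.r_eq e he] at h1
  have h3 : HasLineDerivAt ℝ (fun e ↦ (χ e - 1) / (χ e * r e ^ 2)) _ e (1, χ e) :=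
    HasDerivAt.fun_div (HasDerivAt.sub_const 1 h2)
      (HasDerivAt.fun_mul h2 (HasDerivAt.fun_pow h1 2)) (by simp [hχ, hr])
  have h4 : DifferentiableAt ℝ (fun e ↦ (χ e - 1) / (χ e * r e ^ 2)) e := by
    have hrd := (h.r_smooth e he).differentiableAt (by simp : (∞ : WithTop ℕ∞) ≠ 0)
    have hχd := (h.χ_smooth e he).differentiableAt (by simp : (∞ : WithTop ℕ∞) ≠ 0)
    fun_prop (disch := exact mul_ne_zero hχ (pow_ne_zero 2 hr))
  rw [← (h4.hasFDerivAt.hasLineDerivAt (1, χ e)).lineDeriv, h3.lineDeriv]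
  simp only [zero_smul, add_zero]
  field_simp
  ring

/-- `(τ''_p)_s = ((ρ + p)(χ χ'_p + χ'_ρ) + 2 χ (1 - χ)) / (χ³ r² (ρ + p))`. -/
theorem iteratedDeriv_expressed {τ : ℝ × ℝ → ℝ} {e : ℝ × ℝ} (he : e ∈ U)
    (hτ : IsExpressedBy s (dynamicVolume r) τ e) :
    iteratedDeriv 2 (fun b ↦ τ (s e, b)) e.2 =
      ((e.1 + e.2) * fderiv ℝ χ e (1, χ e) + 2 * χ e * (1 - χ e)) /
        (χ e ^ 3 * r e ^ 2 * (e.1 + e.2)) := by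
  let τ₁ : ℝ × ℝ → ℝ := fun q ↦ fderiv ℝ τ q (0, 1)
  have hτd : ∀ᶠ q in 𝓝 (s e, e.2), DifferentiableAt ℝ τ q := by
    have : ContDiffAt ℝ 1 τ (s e, e.2) := hτ.smooth.of_le (by simp)
    filter_upwards [this.eventually (by exact_mod_cast ENat.one_ne_top)] with q hq
    exact hq.differentiableAt (by simp)
  have hτ₁ : DifferentiableAt ℝ τ₁ (s e, e.2) :=
    ((hτ.smooth.fderiv_right (m := ∞) (by simp)).clm_apply contDiffAt_const).differentiableAt
      (by simp)
  have hsc : ContinuousAt (fun e' : ℝ × ℝ ↦ (s e', e'.2)) e :=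
    (h.s_smooth e he).continuousAt.prodMk continuousAt_snd
  -- The slope formula holds on a neighbourhood, so it can again be differentiated along `(1, χ)`.
  have heq₁ : ∀ᶠ e' in 𝓝 e, (χ e' - 1) / (χ e' * r e' ^ 2) = τ₁ (s e', e'.2) := by
    filter_upwards [h.isOpen.mem_nhds he, hsc.eventually hτd, hτ.eq.eventually_nhds]
      with e' h1 h2 h3
    exact (h.fderiv_expressed h1 h2 h3).symm
  have h1 := fderiv_of_eventuallyEq_comp ((h.s_smooth e he).differentiableAt (by simp)) hτ₁ heq₁
    (1, χ e)
  rw [h.s_eq e he, h.fderiv_slope he] at h1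
  have h2 : ((0 : ℝ), χ e) = χ e • ((0 : ℝ), (1 : ℝ)) := by ext <;> simp
  simp only [h2, map_smul, smul_eq_mul] at h1
  have h3 : deriv (fun b ↦ τ (s e, b)) =ᶠ[𝓝 e.2] fun b ↦ τ₁ (s e, b) := by
    have hc : ContinuousAt (fun b : ℝ ↦ (s e, b)) e.2 := by fun_prop
    filter_upwards [hc.eventually hτd] with b hb using partialP_eq_fderiv hb
  rw [iteratedDeriv_succ, iteratedDeriv_one, h3.deriv_eq]
  refine (partialP_eq_fderiv hτ₁).trans ?_
  have hr := (h.r_pos e he).ne'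
  have hw := (h.pos e he).ne'
  have hχ := h.χ_ne e he
  field_simp at h1 ⊢
  linarith

theorem indicatrixH1_iff {e : ℝ × ℝ} (he : e ∈ U) :
    IndicatrixH1 χ e ↔ (χ e - 1) / (χ e * r e ^ 2) < 0 ∧
      0 < ((e.1 + e.2) * fderiv ℝ χ e (1, χ e) + 2 * χ e * (1 - χ e)) /
        (χ e ^ 3 * r e ^ 2 * (e.1 + e.2)) := by
  have hr := h.r_pos e he
  have hw := h.pos e he
  have hd := (h.χ_smooth e he).differentiableAt (by simp)
  have key : (0 < χ e ∧ χ e < 1) ↔ (χ e - 1) / (χ e * r e ^ 2) < 0 := by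
    rw [← div_div, div_lt_iff₀ (by positivity), zero_mul, div_neg_iff]
    constructor
    · rintro ⟨h1, h2⟩
      exact Or.inr ⟨by linarith, h1⟩
    · rintro (⟨h1, h2⟩ | ⟨h1, h2⟩)
      · linarith
      · exact ⟨h2, by linarith⟩
  rw [IndicatrixH1, ← and_assoc, key, partialRho_eq_fderiv hd, partialP_eq_fderiv hd, map_one_mk _ (χ e),
    add_comm (χ e * _)]
  refine and_congr_right fun h1 ↦ ?_
  have hχ := (key.mpr h1).1
  rw [lt_div_iff₀ (by positivity), zero_mul]

/-- Both derivative formulas hold for every `τ` expressing the dynamic volume, so any one of them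
decides H₁. -/
theorem condH1_iff {e : ℝ × ℝ} (he : e ∈ U)
    (hex : ∃ τ, IsExpressedBy s (dynamicVolume r) τ e) : CondH1 r s e ↔ IndicatrixH1 χ e := by
  rw [h.indicatrixH1_iff he]
  constructor
  · rintro ⟨τ, hτ, h1, h2⟩
    rw [h.deriv_expressed he hτ] at h1
    rw [h.iteratedDeriv_expressed he hτ] at h2
    exact ⟨h1, h2⟩
  · rintro ⟨h1, h2⟩
    obtain ⟨τ, hτ⟩ := hex
    refine ⟨τ, hτ, ?_, ?_⟩
    · rwa [h.deriv_expressed he hτ]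
    · rwa [h.iteratedDeriv_expressed he hτ]

/-- `(τ'_s)_p s'_ρ = (r - 2 (ρ + p) r'_ρ) / r³`. -/
theorem deriv_entropy_expressed {τ : ℝ × ℝ → ℝ} {e : ℝ × ℝ} (he : e ∈ U)
    (hτ : IsExpressedBy s (dynamicVolume r) τ e) :
    deriv (fun a ↦ τ (a, e.2)) (s e) * fderiv ℝ s e (1, 0) =
      (r e - 2 * ((e.1 + e.2) * fderiv ℝ r e (1, 0))) / r e ^ 3 := by
  have hr := (h.r_pos e he).ne'
  have hd := hτ.smooth.differentiableAt (by simp)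
  have h1 := fderiv_of_eventuallyEq_comp ((h.s_smooth e he).differentiableAt (by simp)) hd hτ.eq
    (1, 0)
  rw [_root_.fderiv_dynamicVolume ((h.r_smooth e he).differentiableAt (by simp)) hr] at h1
  have h2 : (fderiv ℝ s e (1, 0), (0 : ℝ)) = fderiv ℝ s e (1, 0) • ((1 : ℝ), (0 : ℝ)) := by
    ext <;> simp
  simp only [h2, map_smul, smul_eq_mul] at h1
  have h3 : deriv (fun a ↦ τ (a, e.2)) (s e) = fderiv ℝ τ (s e, e.2) (1, 0) :=
    partialRho_eq_fderiv hd
  rw [h3, mul_comm, ← h1]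
  field_simp
  ring

/-- By the inverse function theorem `(s, p)` is a local chart; compose the dynamic volume with its
inverse. -/
theorem exists_expressed {e : ℝ × ℝ} (he : e ∈ U) (hs : fderiv ℝ s e (1, 0) ≠ 0) :
    ∃ τ, IsExpressedBy s (dynamicVolume r) τ e := by
  let f : ℝ × ℝ → ℝ × ℝ := fun e ↦ (s e, e.2)
  have hf : ∀ᶠ x in 𝓝 e, ContDiffAt ℝ ∞ f x := by
    filter_upwards [h.isOpen.mem_nhds he] with x hx
    exact (h.s_smooth x hx).prodMk contDiffAt_snd
  have hsd := (h.s_smooth e he).differentiableAt (by simp : (∞ : WithTop ℕ∞) ≠ 0)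
  let A := fderiv ℝ s e
  let p₁ := ContinuousLinearMap.fst ℝ ℝ ℝ
  let p₂ := ContinuousLinearMap.snd ℝ ℝ ℝ
  have hA : ∀ q : ℝ × ℝ, A q = q.1 * A (1, 0) + q.2 * A (0, 1) := fun q ↦ by
    have h1 : q = q.1 • ((1 : ℝ), (0 : ℝ)) + q.2 • ((0 : ℝ), (1 : ℝ)) := by ext <;> simp
    nth_rewrite 1 [h1]
    rw [map_add, map_smul, map_smul, smul_eq_mul, smul_eq_mul]
  have hA1 : A (1, 0) ≠ 0 := hs
  let D : (ℝ × ℝ) ≃L[ℝ] ℝ × ℝ := ContinuousLinearEquiv.equivOfInverse (A.prod p₂)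
    (((A (1, 0))⁻¹ • (p₁ - A (0, 1) • p₂)).prod p₂)
    (fun q ↦ by
      ext
      · change (A (1, 0))⁻¹ * (A q - A (0, 1) * q.2) = q.1
        rw [hA q]; field_simp; ring
      · rfl)
    (fun q ↦ by
      ext
      · change A ((A (1, 0))⁻¹ * (q.1 - A (0, 1) * q.2), q.2) = q.1
        rw [hA]; field_simp; ring
      · rfl)
  obtain ⟨g, hg0, hg, hgf⟩ := exists_smooth_localInverse hf D (hsd.hasFDerivAt.prodMk hasFDerivAt_snd)
  have hr := (h.r_pos e he).ne'
  refine ⟨fun q ↦ dynamicVolume r (g q), ?_, ?_, ?_⟩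
  · rwa [partialRho_eq_fderiv hsd]
  · have h1 : ContDiffAt ℝ ∞ (dynamicVolume r) e := by
      have : dynamicVolume r = fun e ↦ (e.1 + e.2) / r e ^ 2 := funext (dynamicVolume_eq r)
      rw [this]
      exact (contDiffAt_fst.add contDiffAt_snd).div ((h.r_smooth e he).pow 2) (pow_ne_zero 2 hr)
    rw [← hg0] at h1
    exact h1.comp (f e) hg.self_of_nhds.1
  · filter_upwards [hgf] with e' he'
    exact congrArg (dynamicVolume r) he'.symm

theorem condH2_of_lt {e : ℝ × ℝ} (he : e ∈ U) (hs : 0 < fderiv ℝ s e (1, 0))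
    (hr : 2 * ((e.1 + e.2) * fderiv ℝ r e (1, 0)) < r e) : CondH2 r s e := by
  obtain ⟨τ, hτ⟩ := h.exists_expressed he hs.ne'
  refine ⟨τ, hτ, pos_of_mul_pos_left ?_ hs.le⟩
  rw [h.deriv_entropy_expressed he hτ]
  exact div_pos (sub_pos.mpr hr) (pow_pos (h.r_pos e he) 3)

theorem condH2bar_of_lt {e : ℝ × ℝ} (he : e ∈ U) (hs : 0 < fderiv ℝ s e (1, 0))
    (hr : r e < 2 * ((e.1 + e.2) * fderiv ℝ r e (1, 0))) : CondH2bar r s e := by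
  obtain ⟨τ, hτ⟩ := h.exists_expressed he hs.ne'
  refine ⟨τ, hτ, neg_of_mul_neg_left ?_ hs.le⟩
  rw [h.deriv_entropy_expressed he hτ]
  exact div_neg_of_neg_of_pos (sub_neg.mpr hr) (pow_pos (h.r_pos e he) 3)

end SoundOn

/-! ### The energy equation and the set of states -/

namespace PerfectEnergyTensor

variable {M : Type*} [TopologicalSpace M] [ChartedSpace (EuclideanSpace ℝ (Fin 4)) M]
  [IsManifold (𝓡 4) ∞ M] {g : LorentzMetric M} (T : PerfectEnergyTensor g)

theorem fieldDiffAt_u (x : M) : FieldDiffAt T.u x :=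
  (T.u_smooth x).mdifferentiableAt (by simp)

theorem mdifferentiableAt_ρ (x : M) : MDifferentiableAt (𝓡 4) 𝓘(ℝ, ℝ) T.ρ x :=
  (T.ρ_smooth x).mdifferentiableAt (by simp)

theorem mdifferentiableAt_p (x : M) : MDifferentiableAt (𝓡 4) 𝓘(ℝ, ℝ) T.p x :=
  (T.p_smooth x).mdifferentiableAt (by simp)

/-- The acceleration is orthogonal to the velocity. -/
theorem inner_u_acceleration {nabla : AffineConnection M} (hnabla : IsLeviCivita g nabla) (x : M) :
    g.inner x (T.u x) (nabla T.u x (T.u x)) = 0 := by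
  have h := hnabla.metric T.u T.u x (T.fieldDiffAt_u x) (T.fieldDiffAt_u x) (T.u x)
  have h1 : (fun y ↦ g.inner y (T.u y) (T.u y)) = fun _ ↦ (-1 : ℝ) := funext T.unit
  rw [h1, mvfderiv_const, g.symm x (nabla T.u x (T.u x))] at h
  have h2 : (0 : ℝ) = g.inner x (T.u x) (nabla T.u x (T.u x)) +
    g.inner x (T.u x) (nabla T.u x (T.u x)) := h
  linarith

theorem tensor_apply_u (x : M) : T.tensor x (T.u x) = (-T.ρ x) • T.u x := by
  simp only [tensor, add_apply, smul_apply,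
    ContinuousLinearMap.smulRight_apply, ContinuousLinearMap.id_apply, T.unit]
  module

/-- The energy equation `ρ̇ + (ρ + p) θ = 0`. -/
theorem energy_equation {nabla : AffineConnection M} (hnabla : IsLeviCivita g nabla)
    (hcons : T.IsConserved nabla) (x : M) :
    T.dot T.ρ x + (T.ρ x + T.p x) * divergence nabla T.u x = 0 := by
  have : FiniteDimensional ℝ (TangentSpace (𝓡 4) x) :=
    inferInstanceAs (FiniteDimensional ℝ (EuclideanSpace ℝ (Fin 4)))
  -- The test field `u` is an eigenvector of the tensor, with eigenvalue `-ρ`.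
  have h := hcons x T.u (T.fieldDiffAt_u x)
  have h1 : (fun y ↦ T.tensor y (T.u y)) = (-T.ρ) • T.u := funext T.tensor_apply_u
  have h2 : nabla ((-T.ρ) • T.u) x = (-T.ρ) x • nabla T.u x +
      (mvfderiv (𝓡 4) (-T.ρ) x).smulRight (T.u x) :=
    nabla.isCovariantDerivativeOnUniv.leibniz (T.fieldDiffAt_u x) (T.mdifferentiableAt_ρ x).neg
  have h3 : LinearMap.trace ℝ (TangentSpace (𝓡 4) x)
      ((mvfderiv (𝓡 4) (-T.ρ) x).smulRight (T.u x)).toLinearMap = - T.dot T.ρ x := by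
    refine (LinearMap.trace_smulRight
      ((mvfderiv (𝓡 4) (-T.ρ) x).toLinearMap) (T.u x)).trans ?_
    rw [mvfderiv_neg]
    rfl
  have h4 : ((T.tensor x).comp (nabla T.u x)).toLinearMap =
      (T.ρ x + T.p x) • ((g.inner x (T.u x)).comp (nabla T.u x)).toLinearMap.smulRight (T.u x) +
        T.p x • (nabla T.u x).toLinearMap := by
    ext v
    rfl
  have h5 : LinearMap.trace ℝ (TangentSpace (𝓡 4) x)
      (((g.inner x (T.u x)).comp (nabla T.u x)).toLinearMap.smulRight (T.u x)) = 0 :=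
    (LinearMap.trace_smulRight _ (T.u x)).trans (T.inner_u_acceleration hnabla x)
  have h6 : divergence nabla ((-T.ρ) • T.u) x =
      -T.ρ x * divergence nabla T.u x - T.dot T.ρ x := by
    unfold divergence
    rw [h2, ContinuousLinearMap.toLinearMap_add, map_add, h3, ContinuousLinearMap.toLinearMap_smul,
      map_smul]
    rfl
  rw [tensorDivergence, h1, h6, h4, map_add, map_smul, map_smul, h5] at h
  have h7 : -T.ρ x * divergence nabla T.u x - T.dot T.ρ x -
    ((T.ρ x + T.p x) * 0 + T.p x * divergence nabla T.u x) = 0 := h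
  linarith

/-- The differential of the state, `v ↦ (dρ v, dp v)`. -/
def stateDifferential (x : M) : TangentSpace (𝓡 4) x →L[ℝ] ℝ × ℝ :=
  (mvfderiv (𝓡 4) T.ρ x).prod (mvfderiv (𝓡 4) T.p x)

theorem hasMFDerivAt_state (x : M) :
    HasMFDerivAt (𝓡 4) 𝓘(ℝ, ℝ × ℝ) T.state x (T.stateDifferential x) :=
  ⟨(T.ρ_smooth x).continuousAt.prodMk (T.p_smooth x).continuousAt,
    (T.mdifferentiableAt_ρ x).hasMFDerivAt.2.prodMk (T.mdifferentiableAt_p x).hasMFDerivAt.2⟩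

theorem dot_comp_state {z : ℝ × ℝ → ℝ} {x : M} (hz : DifferentiableAt ℝ z (T.state x)) :
    T.dot (fun y ↦ z (T.state y)) x = fderiv ℝ z (T.state x) (T.dot T.ρ x, T.dot T.p x) := by
  have h : HasMFDerivAt (𝓡 4) 𝓘(ℝ, ℝ) (fun y ↦ z (T.state y)) x _ :=
    HasMFDerivAt.comp x hz.hasFDerivAt.hasMFDerivAt (T.hasMFDerivAt_state x)
  unfold dot mvfderiv
  rw [h.mfderiv]
  rfl

theorem dot_comp_state_eq_mul (hiso : T.IsNonIsoenergetic) {z : ℝ × ℝ → ℝ} {x : M}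
    (hz : DifferentiableAt ℝ z (T.state x)) :
    T.dot (fun y ↦ z (T.state y)) x =
      T.dot T.ρ x * fderiv ℝ z (T.state x) (1, T.indicatrix x) := by
  rw [T.dot_comp_state hz, ← smul_eq_mul, ← map_smul]
  congr 1
  have := hiso x
  ext
  · simp
  · simp only [indicatrix, Prod.smul_mk, smul_eq_mul]
    field_simp

/-- A nonzero functional vanishing on the range would be a linear relation between `dρ` and `dp`. -/
theorem surjective_stateDifferential (hbar : T.IsNonBarotropic) (x : M) :
    (T.stateDifferential x).range = ⊤ := by
  by_contra hne
  obtain ⟨ψ, hψ, hle⟩ := Submodule.exists_le_ker_of_lt_top _ (lt_top_iff_ne_top.mpr hne)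
  have h := LinearIndependent.pair_iff.mp (hbar x) (ψ (1, 0)) (ψ (0, 1)) ?_
  · refine hψ (LinearMap.ext fun q ↦ ?_)
    have h1 : q = q.1 • ((1 : ℝ), (0 : ℝ)) + q.2 • ((0 : ℝ), (1 : ℝ)) := by ext <;> simp
    rw [h1, map_add, map_smul, map_smul, h.1, h.2]
    simp
  · ext v
    have h2 : ψ (T.stateDifferential x v) = 0 := hle ⟨v, rfl⟩
    have h1 : T.stateDifferential x v = (mvfderiv (𝓡 4) T.ρ x v) • ((1 : ℝ), (0 : ℝ)) +
        (mvfderiv (𝓡 4) T.p x v) • ((0 : ℝ), (1 : ℝ)) := by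
      ext <;> simp [stateDifferential]
    rw [h1, map_add, map_smul, map_smul] at h2
    simpa [mul_comm] using h2

/-- The states of a non barotropic flow form an open set. -/
theorem isOpen_range_state (hbar : T.IsNonBarotropic) : IsOpen (Set.range T.state) := by
  refine isOpen_iff_mem_nhds.mpr ?_
  rintro _ ⟨x, rfl⟩
  have hs : ContMDiffAt (𝓡 4) 𝓘(ℝ, ℝ × ℝ) ∞ T.state x :=
    (T.ρ_smooth x).prodMk_space (T.p_smooth x)
  have h1 := (contMDiffAt_iff.mp hs).2
  have h2 := (T.hasMFDerivAt_state x).2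
  simp only [writtenInExtChartAt, extChartAt_model_space_eq_id, PartialEquiv.refl_coe,
    Function.id_comp, ModelWithCorners.range_eq_univ, contDiffWithinAt_univ] at h1 h2
  have h3 := h1.hasStrictFDerivAt'
    (f' := (T.stateDifferential x : EuclideanSpace ℝ (Fin 4) →L[ℝ] ℝ × ℝ))
    (hasFDerivWithinAt_univ.mp h2) (by simp)
  -- A strict derivative that is onto makes the map open at the point, here in a chart.
  have h4 := h3.map_nhds_eq_of_surj (T.surjective_stateDifferential hbar x)
  have h5 : (T.state ∘ (extChartAt (𝓡 4) x).symm) (extChartAt (𝓡 4) x x) = T.state x := by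
    simp
  rw [h5] at h4
  rw [← h4]
  refine Filter.mem_map.mpr (Filter.Eventually.of_forall fun y ↦ ⟨_, rfl⟩)

end PerfectEnergyTensor

/-! ### Temperature and local solutions for a given indicatrix -/

namespace SoundOn

variable {χ r s : ℝ × ℝ → ℝ} {U : Set (ℝ × ℝ)} (h : SoundOn χ r s U)
include h

theorem fderiv_r_p {e : ℝ × ℝ} (he : e ∈ U) :
    χ e * fderiv ℝ r e (0, 1) = r e / (e.1 + e.2) - fderiv ℝ r e (1, 0) := by
  rw [← h.r_eq e he, map_one_mk _ (χ e)]
  ring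

theorem fderiv_s_p {e : ℝ × ℝ} (he : e ∈ U) :
    χ e * fderiv ℝ s e (0, 1) = -fderiv ℝ s e (1, 0) := by
  have := h.s_eq e he
  rw [map_one_mk _ (χ e)] at this
  linarith

/-- The temperature is determined by the energy balance. -/
theorem isThermodynamics (hs : ∀ e ∈ U, fderiv ℝ s e (1, 0) ≠ 0) :
    IsThermodynamics U r s (fun e ↦ (r e - (e.1 + e.2) * fderiv ℝ r e (1, 0)) /
      (r e ^ 2 * fderiv ℝ s e (1, 0))) where
  isOpen := h.isOpen
  r_smooth e he := (h.r_smooth e he).contDiffWithinAt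
  s_smooth e he := (h.s_smooth e he).contDiffWithinAt
  r_pos := h.r_pos
  Θ_smooth e he := by
    have hr : ContDiffAt ℝ ∞ (fun e ↦ fderiv ℝ r e (1, 0)) e :=
      ((h.r_smooth e he).fderiv_right (m := ∞) (by simp)).clm_apply contDiffAt_const
    have hs' : ContDiffAt ℝ ∞ (fun e ↦ fderiv ℝ s e (1, 0)) e :=
      ((h.s_smooth e he).fderiv_right (m := ∞) (by simp)).clm_apply contDiffAt_const
    refine ContDiffAt.contDiffWithinAt (ContDiffAt.div
      ((h.r_smooth e he).sub ((contDiffAt_fst.add contDiffAt_snd).mul hr))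
      (((h.r_smooth e he).pow 2).mul hs') ?_)
    exact mul_ne_zero (pow_ne_zero 2 (h.r_pos e he).ne') (hs e he)
  -- Here `dε + p dv = dρ / r - (ρ + p) dr / r²` vanishes on `(1, χ)`, as `ds` does, so the two
  -- forms are proportional. The `ρ` component determines `Θ`, and the `p` component then agrees.
  balance e he := by
    have hr0 := (h.r_pos e he).ne'
    have hw := (h.pos e he).ne'
    have hχ := h.χ_ne e he
    have hs0 := hs e he
    have hrd := (h.r_smooth e he).differentiableAt (by simp : (∞ : WithTop ℕ∞) ≠ 0)
    have hv : HasFDerivAt (specificVolume r) (-(r e ^ 2)⁻¹ • fderiv ℝ r e) e := by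
      have h1 := (hasDerivAt_inv hr0).comp_hasFDerivAt e hrd.hasFDerivAt
      refine h1.congr_of_eventuallyEq (Filter.Eventually.of_forall fun e' ↦ ?_)
      simp [specificVolume]
    have hε : HasFDerivAt (internalEnergy r)
        (e.1 • (-(r e ^ 2)⁻¹ • fderiv ℝ r e) +
          specificVolume r e • ContinuousLinearMap.fst ℝ ℝ ℝ) e := by
      have h1 : HasFDerivAt (fun e' : ℝ × ℝ ↦ e'.1 * specificVolume r e' - 1) _ e :=
        (hasFDerivAt_fst.fun_mul hv).sub_const 1
      refine h1.congr_of_eventuallyEq (Filter.Eventually.of_forall fun e' ↦ ?_)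
      simp [specificVolume, internalEnergy, div_eq_mul_inv]
    rw [hv.fderiv, hε.fderiv]
    have hrp := h.fderiv_r_p he
    have hsp := h.fderiv_s_p he
    have hrp' : fderiv ℝ r e (0, 1) = (r e / (e.1 + e.2) - fderiv ℝ r e (1, 0)) / χ e := by
      field_simp at hrp ⊢; linarith
    have hsp' : fderiv ℝ s e (0, 1) = -fderiv ℝ s e (1, 0) / χ e := by
      field_simp at hsp ⊢; linarith
    ext
    · simp only [ContinuousLinearMap.comp_apply, ContinuousLinearMap.inl_apply, add_apply,
        smul_apply, smul_eq_mul, ContinuousLinearMap.coe_fst', specificVolume]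
      field_simp
      ring
    · simp only [ContinuousLinearMap.comp_apply, ContinuousLinearMap.inr_apply, add_apply,
        smul_apply, smul_eq_mul, ContinuousLinearMap.coe_fst', specificVolume, hrp', hsp']
      field_simp
      ring

theorem solvesSound {e : ℝ × ℝ} (he : e ∈ U) (hs : fderiv ℝ s e (1, 0) ≠ 0)
    (hr : (e.1 + e.2) * fderiv ℝ r e (1, 0) < r e) : SolvesSound χ r s e := by
  have hw := h.pos e he
  have hχ := h.χ_ne e he
  have hrd := (h.r_smooth e he).differentiableAt (by simp : (∞ : WithTop ℕ∞) ≠ 0)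
  have hsd := (h.s_smooth e he).differentiableAt (by simp : (∞ : WithTop ℕ∞) ≠ 0)
  have hrp := h.fderiv_r_p he
  have hsp := h.fderiv_s_p he
  have hr0 : r e / (e.1 + e.2) - fderiv ℝ r e (1, 0) ≠ 0 := by
    refine (sub_pos.mpr ?_).ne'
    rw [lt_div_iff₀ hw]
    linarith
  rw [SolvesSound, partialP_eq_fderiv hrd, partialP_eq_fderiv hsd, partialRho_eq_fderiv hrd,
    partialRho_eq_fderiv hsd]
  have h1 : fderiv ℝ s e (0, 1) ≠ 0 := fun h0 ↦ hs (by rw [h0] at hsp; linarith)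
  have h2 : fderiv ℝ r e (0, 1) ≠ 0 := fun h0 ↦ hr0 (by rw [h0] at hrp; linarith)
  refine ⟨h1, h2, ?_, ?_⟩
  · rw [← hsp]; field_simp
  · rw [← hrp]; field_simp

end SoundOn

/-- Local solutions of the equations for a given indicatrix. The rate `c` at which the matter
density grows with the energy density at constant pressure is free at the centre. -/
theorem exists_soundOn {χ : ℝ × ℝ → ℝ} {e₀ : ℝ × ℝ} (hχ : ∀ᶠ e in 𝓝 e₀, ContDiffAt ℝ ∞ χ e)
    (hχ₀ : 0 < χ e₀) (hw₀ : 0 < e₀.1 + e₀.2) {c : ℝ} (hc : c < 1) :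
    ∃ (r s : ℝ × ℝ → ℝ) (U : Set (ℝ × ℝ)), e₀ ∈ U ∧ SoundOn χ r s U ∧
      (∀ e ∈ U, 0 < fderiv ℝ s e (1, 0) ∧ (e.1 + e.2) * fderiv ℝ r e (1, 0) < r e) ∧
      (e₀.1 + e₀.2) * fderiv ℝ r e₀ (1, 0) = c * r e₀ := by
  -- With the factor `ρ + p`, the time function of the field is a solution for `ln r`.
  have hV : ∀ᶠ e in 𝓝 e₀, ContDiffAt ℝ ∞
      (fun e : ℝ × ℝ ↦ (e.1 + e.2) • ((1 : ℝ), χ e)) e := by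
    filter_upwards [hχ] with e he
    exact (contDiffAt_fst.add contDiffAt_snd).smul (contDiffAt_const.prodMk he)
  obtain ⟨T, S, hTS, hS₀⟩ := exists_time_firstIntegral hV (by simpa using hw₀.ne')
  have hpos : ∀ᶠ e : ℝ × ℝ in 𝓝 e₀, 0 < e.1 + e.2 :=
    (by fun_prop : ContinuousAt (fun e : ℝ × ℝ ↦ e.1 + e.2) e₀).eventually_const_lt hw₀
  have hχpos : ∀ᶠ e in 𝓝 e₀, 0 < χ e :=
    hχ.self_of_nhds.continuousAt.eventually_const_lt hχ₀
  have hline : ∀ᶠ e in 𝓝 e₀, fderiv ℝ T e (1, χ e) = 1 / (e.1 + e.2) ∧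
      fderiv ℝ S e (1, χ e) = 0 := by
    filter_upwards [hTS, hpos] with e ⟨_, _, h1, h2⟩ h3
    rw [map_smul, smul_eq_mul] at h1 h2
    exact ⟨by field_simp; linarith, (mul_eq_zero.mp h2).resolve_left h3.ne'⟩
  have hSρ : fderiv ℝ S e₀ (1, 0) = -χ e₀ := by
    have := hline.self_of_nhds.2
    rw [map_one_mk _ (χ e₀), hS₀] at this
    linarith
  -- Solves `(ρ + p)(T'_ρ + k S'_ρ) = c` at `e₀`, where `S'_ρ = -χ`.
  let k := (fderiv ℝ T e₀ (1, 0) - c / (e₀.1 + e₀.2)) / χ e₀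
  let r : ℝ × ℝ → ℝ := fun e ↦ Real.exp (T e + k * S e)
  -- The sign makes `s'_ρ = χ > 0` at `e₀`.
  let s : ℝ × ℝ → ℝ := fun e ↦ -S e
  have hrs : ∀ᶠ e in 𝓝 e₀, ContDiffAt ℝ ∞ r e ∧ ContDiffAt ℝ ∞ s e ∧
      (∀ v, fderiv ℝ r e v = r e * (fderiv ℝ T e v + k * fderiv ℝ S e v)) ∧
      ∀ v, fderiv ℝ s e v = -fderiv ℝ S e v := by
    filter_upwards [hTS] with e ⟨hT, hS, _, _⟩
    refine ⟨(hT.add (contDiffAt_const.mul hS)).exp, hS.neg, fun v ↦ ?_, fun v ↦ ?_⟩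
    · have h1 : HasFDerivAt r _ e := ((hT.differentiableAt (by simp)).hasFDerivAt.fun_add
        ((hS.differentiableAt (by simp)).hasFDerivAt.const_mul k)).exp
      rw [h1.fderiv]
      rfl
    · rw [(hS.differentiableAt (by simp)).hasFDerivAt.fun_neg.fderiv]
      rfl
  have hrρ : (e₀.1 + e₀.2) * fderiv ℝ r e₀ (1, 0) = c * r e₀ := by
    rw [hrs.self_of_nhds.2.2.1, hSρ]
    simp only [k]
    field_simp
    ring
  have hs_pos : ∀ᶠ e in 𝓝 e₀, 0 < fderiv ℝ s e (1, 0) := by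
    have hcont : ContinuousAt (fun e ↦ fderiv ℝ s e (1, 0)) e₀ :=
      ((hrs.self_of_nhds.2.1.fderiv_right (m := ∞) (by simp)).clm_apply
        contDiffAt_const).continuousAt
    refine hcont.eventually_const_lt ?_
    beta_reduce
    rw [hrs.self_of_nhds.2.2.2, hSρ, neg_neg]
    exact hχ₀
  have hr_lt : ∀ᶠ e in 𝓝 e₀, (e.1 + e.2) * fderiv ℝ r e (1, 0) < r e := by
    refine ContinuousAt.eventually_lt (f := fun e ↦ (e.1 + e.2) * fderiv ℝ r e (1, 0)) ?_
      hrs.self_of_nhds.1.continuousAt ?_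
    · exact (by fun_prop : ContinuousAt (fun e : ℝ × ℝ ↦ e.1 + e.2) e₀).mul
        ((hrs.self_of_nhds.1.fderiv_right (m := ∞) (by simp)).clm_apply
          contDiffAt_const).continuousAt
    · rw [hrρ]
      exact mul_lt_of_lt_one_left (Real.exp_pos _) hc
  obtain ⟨U, hU, hUo, heU⟩ := mem_nhds_iff.mp
    (hχ.and (hpos.and (hχpos.and (hline.and (hrs.and (hs_pos.and hr_lt))))))
  refine ⟨r, s, U, heU, ⟨hUo, fun e he ↦ (hU he).2.2.2.2.1.1, fun e he ↦ (hU he).2.2.2.2.1.2.1,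
    fun e he ↦ (hU he).1, fun e he ↦ (hU he).2.1, fun e _ ↦ Real.exp_pos _,
    fun e he ↦ (hU he).2.2.1.ne', fun e he ↦ ?_, fun e he ↦ ?_⟩, fun e he ↦
      (hU he).2.2.2.2.2, hrρ⟩
  · obtain ⟨h1, h2⟩ := (hU he).2.2.2.1
    rw [(hU he).2.2.2.2.1.2.2.1, h1, h2, mul_zero, add_zero, mul_one_div]
  · rw [(hU he).2.2.2.2.1.2.2.2, (hU he).2.2.2.1.2, neg_zero]

theorem SoundOn.mono {χ r s : ℝ × ℝ → ℝ} {U V : Set (ℝ × ℝ)} (h : SoundOn χ r s U) (hV : IsOpen V)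
    (hVU : V ⊆ U) : SoundOn χ r s V :=
  ⟨hV, fun e he ↦ h.r_smooth e (hVU he), fun e he ↦ h.s_smooth e (hVU he),
    fun e he ↦ h.χ_smooth e (hVU he), fun e he ↦ h.pos e (hVU he), fun e he ↦ h.r_pos e (hVU he),
    fun e he ↦ h.χ_ne e (hVU he), fun e he ↦ h.r_eq e (hVU he), fun e he ↦ h.s_eq e (hVU he)⟩

/-! ### The two implications -/

namespace PerfectEnergyTensor

variable {M : Type*} [TopologicalSpace M] [ChartedSpace (EuclideanSpace ℝ (Fin 4)) M]
  [IsManifold (𝓡 4) ∞ M] {g : LorentzMetric M} {T : PerfectEnergyTensor g}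
  {nabla : AffineConnection M}

theorem evolves_of_soundOn (hnabla : IsLeviCivita g nabla) (hcons : T.IsConserved nabla)
    (hiso : T.IsNonIsoenergetic) {χ r s : ℝ × ℝ → ℝ} {U : Set (ℝ × ℝ)} (h : SoundOn χ r s U)
    (hχ : ∀ x, T.indicatrix x = χ (T.state x)) : T.Evolves nabla U r s := by
  intro x hx
  rw [T.dot_comp_state_eq_mul hiso ((h.r_smooth _ hx).differentiableAt (by simp)),
    T.dot_comp_state_eq_mul hiso ((h.s_smooth _ hx).differentiableAt (by simp)), hχ, h.r_eq _ hx,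
    h.s_eq _ hx, mul_zero]
  refine ⟨?_, rfl⟩
  have h1 := T.energy_equation hnabla hcons x
  have h2 : T.ρ x + T.p x ≠ 0 := (h.pos _ hx).ne'
  simp only [state]
  field_simp
  linear_combination r (T.ρ x, T.p x) * h1

theorem equations_of_evolves (hnabla : IsLeviCivita g nabla) (hcons : T.IsConserved nabla)
    (hiso : T.IsNonIsoenergetic) (hpos : ∀ x, 0 < T.ρ x + T.p x) {r s Θ : ℝ × ℝ → ℝ}
    {D : Set (ℝ × ℝ)} (hD : IsThermodynamics D r s Θ) (h : T.Evolves nabla D r s) {x : M}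
    (hx : T.state x ∈ D) :
    fderiv ℝ r (T.state x) (1, T.indicatrix x) =
        r (T.state x) / ((T.state x).1 + (T.state x).2) ∧
      fderiv ℝ s (T.state x) (1, T.indicatrix x) = 0 := by
  have hDx := hD.isOpen.mem_nhds hx
  obtain ⟨h1, h2⟩ := h x hx
  rw [T.dot_comp_state_eq_mul hiso
    ((hD.r_smooth.contDiffAt hDx).differentiableAt (by simp))] at h1
  rw [T.dot_comp_state_eq_mul hiso
    ((hD.s_smooth.contDiffAt hDx).differentiableAt (by simp))] at h2
  refine ⟨?_, (mul_eq_zero.mp h2).resolve_left (hiso x)⟩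
  have h3 := T.energy_equation hnabla hcons x
  have h4 := hpos x
  refine mul_left_cancel₀ (hiso x) ?_
  simp only [state] at h1 ⊢
  field_simp
  linear_combination (T.ρ x + T.p x) * h1 - r (T.ρ x, T.p x) * h3

/-- Treats H₂ and H̄₂ together: `Q` is an open condition on `((ρ + p) r'_ρ, r)` that holds at the
centre by the choice of `c`, hence nearby, and implies `C`. -/
theorem canBeEndowed (hnabla : IsLeviCivita g nabla) (hcons : T.IsConserved nabla)
    (hiso : T.IsNonIsoenergetic) (hpos : ∀ x, 0 < T.ρ x + T.p x) (hbar : T.IsNonBarotropic)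
    {χ : ℝ × ℝ → ℝ} (hχ : T.IndicatrixEq χ) (hH1 : ∀ x, IndicatrixH1 χ (T.state x))
    {c : ℝ} (hc : c < 1) {Q : ℝ → ℝ → Prop}
    (hQ : IsOpen {q : ℝ × ℝ | Q q.1 q.2}) (hQc : ∀ a, 0 < a → Q (c * a) a)
    {C : (ℝ × ℝ → ℝ) → (ℝ × ℝ → ℝ) → ℝ × ℝ → Prop}
    (hC : ∀ {r s : ℝ × ℝ → ℝ} {U : Set (ℝ × ℝ)}, SoundOn χ r s U → ∀ e ∈ U,
      0 < fderiv ℝ s e (1, 0) → Q ((e.1 + e.2) * fderiv ℝ r e (1, 0)) (r e) → C r s e) :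
    T.CanBeEndowed nabla χ (fun r s e ↦ CondH1 r s e ∧ C r s e) := by
  obtain ⟨⟨D, hDo, hDr, hDs⟩, hχeq⟩ := hχ
  intro x
  have hχs : ∀ᶠ e in 𝓝 (T.state x), ContDiffAt ℝ ∞ χ e := by
    filter_upwards [hDo.mem_nhds (hDr ⟨x, rfl⟩)] with e he
    exact hDs.contDiffAt (hDo.mem_nhds he)
  obtain ⟨r, s, U, hxU, hU, hUs, hrc⟩ := exists_soundOn hχs (hH1 x).1 (hpos x) hc
  have hQe : ∀ᶠ e in 𝓝 (T.state x), Q ((e.1 + e.2) * fderiv ℝ r e (1, 0)) (r e) := by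
    have hcont : ContinuousAt
        (fun e : ℝ × ℝ ↦ ((e.1 + e.2) * fderiv ℝ r e (1, 0), r e)) (T.state x) :=
      ((by fun_prop : ContinuousAt (fun e : ℝ × ℝ ↦ e.1 + e.2) (T.state x)).mul
        (((hU.r_smooth _ hxU).fderiv_right (m := ∞) (by simp)).clm_apply
          contDiffAt_const).continuousAt).prodMk (hU.r_smooth _ hxU).continuousAt
    refine hcont.eventually (hQ.mem_nhds ?_)
    change Q (((T.state x).1 + (T.state x).2) * fderiv ℝ r (T.state x) (1, 0)) (r (T.state x))
    rw [hrc]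
    exact hQc _ (hU.r_pos _ hxU)
  -- The inequalities for `χ` are known only at states of the flow, so the domain is shrunk into the
  -- open set of states.
  obtain ⟨V, hV, hVo, hxV⟩ := mem_nhds_iff.mp (Filter.inter_mem (hU.isOpen.mem_nhds hxU)
    (Filter.inter_mem hQe ((T.isOpen_range_state hbar).mem_nhds ⟨x, rfl⟩)))
  have hVs := hU.mono hVo fun e he ↦ (hV he).1
  refine ⟨V, r, s, _, hxV, hVs.isThermodynamics fun e he ↦ (hUs e (hV he).1).1.ne',
    fun e he ↦ ?_, T.evolves_of_soundOn hnabla hcons hiso hVs hχeq, fun e he ↦ ?_,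
    fun e he ↦ ⟨?_, ?_⟩⟩
  · obtain ⟨h1, h2⟩ := hUs e (hV he).1
    exact div_pos (sub_pos.mpr h2) (mul_pos (pow_pos (hVs.r_pos e he) 2) h1)
  · obtain ⟨h1, h2⟩ := hUs e (hV he).1
    exact hVs.solvesSound he h1.ne' h2
  · obtain ⟨y, rfl⟩ := (hV he).2.2
    exact (hVs.condH1_iff he (hVs.exists_expressed he (hUs _ (hV he).1).1.ne')).mpr (hH1 y)
  · exact hC hVs e he (hUs e (hV he).1).1 (hV he).2.1

theorem canBeEndowed_condH2 (hnabla : IsLeviCivita g nabla) (hcons : T.IsConserved nabla)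
    (hiso : T.IsNonIsoenergetic) (hpos : ∀ x, 0 < T.ρ x + T.p x) (hbar : T.IsNonBarotropic)
    {χ : ℝ × ℝ → ℝ} (hχ : T.IndicatrixEq χ) (hH1 : ∀ x, IndicatrixH1 χ (T.state x)) :
    T.CanBeEndowed nabla χ (fun r s e ↦ CondH1 r s e ∧ CondH2 r s e) :=
  canBeEndowed hnabla hcons hiso hpos hbar hχ hH1 (c := 0) (Q := fun a b ↦ 2 * a < b) (by norm_num)
    (isOpen_lt (by fun_prop) (by fun_prop)) (fun a ha ↦ by linarith)
    fun h _ he hs hr ↦ h.condH2_of_lt he hs hr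

theorem canBeEndowed_condH2bar (hnabla : IsLeviCivita g nabla) (hcons : T.IsConserved nabla)
    (hiso : T.IsNonIsoenergetic) (hpos : ∀ x, 0 < T.ρ x + T.p x) (hbar : T.IsNonBarotropic)
    {χ : ℝ × ℝ → ℝ} (hχ : T.IndicatrixEq χ) (hH1 : ∀ x, IndicatrixH1 χ (T.state x)) :
    T.CanBeEndowed nabla χ (fun r s e ↦ CondH1 r s e ∧ CondH2bar r s e) :=
  canBeEndowed hnabla hcons hiso hpos hbar hχ hH1 (c := 3 / 4) (Q := fun a b ↦ b < 2 * a)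
    (by norm_num) (isOpen_lt (by fun_prop) (by fun_prop)) (fun a ha ↦ by linarith)
    fun h _ he hs hr ↦ h.condH2bar_of_lt he hs hr

theorem CanBeEndowed.representsLTE {χ : ℝ × ℝ → ℝ}
    {C : (ℝ × ℝ → ℝ) → (ℝ × ℝ → ℝ) → ℝ × ℝ → Prop} (h : T.CanBeEndowed nabla χ C) :
    T.RepresentsLTE nabla C := fun x ↦
  let ⟨D, r, s, Θ, hx, hD, _, hev, _, hC⟩ := h x
  ⟨D, r, s, Θ, hx, hD, hev, hC⟩

/-- The evolution in l.t.e. under H₁ makes the indicatrix a function of state. -/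
theorem exists_indicatrixEq (hnabla : IsLeviCivita g nabla) (hcons : T.IsConserved nabla)
    (hiso : T.IsNonIsoenergetic) (hpos : ∀ x, 0 < T.ρ x + T.p x) (hbar : T.IsNonBarotropic)
    (h : T.RepresentsLTE nabla CondH1) :
    ∃ χ : ℝ × ℝ → ℝ, T.IndicatrixEq χ ∧ ∀ x, IndicatrixH1 χ (T.state x) := by
  have hloc : ∀ x, ∃ (r s : ℝ × ℝ → ℝ) (U : Set (ℝ × ℝ)), T.state x ∈ U ∧ IsOpen U ∧
      (∀ e ∈ U, ContDiffAt ℝ ∞ r e ∧ ContDiffAt ℝ ∞ s e ∧ 0 < r e ∧ CondH1 r s e ∧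
        fderiv ℝ s e (1, 0) ≠ 0) ∧
      ∀ y, T.state y ∈ U → fderiv ℝ r (T.state y) (1, T.indicatrix y) =
          r (T.state y) / ((T.state y).1 + (T.state y).2) ∧
        fderiv ℝ s (T.state y) (1, T.indicatrix y) = 0 := by
    intro x
    obtain ⟨D, r, s, Θ, hx, hD, hev, hC⟩ := h x
    refine ⟨r, s, D, hx, hD.isOpen, fun e he ↦ ?_,
      fun y hy ↦ equations_of_evolves hnabla hcons hiso hpos hD hev hy⟩
    have hs := hD.s_smooth.contDiffAt (hD.isOpen.mem_nhds he)
    refine ⟨hD.r_smooth.contDiffAt (hD.isOpen.mem_nhds he), hs, hD.r_pos e he, hC e he, ?_⟩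
    obtain ⟨τ, hτ, -⟩ := hC e he
    rw [← partialRho_eq_fderiv (hs.differentiableAt (by simp))]
    exact hτ.coordinates
  have hquot : ∀ {A : ℝ × ℝ →L[ℝ] ℝ} {c : ℝ}, A (1, 0) ≠ 0 → A (1, c) = 0 →
      A (0, 1) ≠ 0 ∧ c = -A (1, 0) / A (0, 1) ∧ c ≠ 0 := by
    intro A c h0 h1
    rw [map_one_mk] at h1
    have h2 : A (0, 1) ≠ 0 := fun h2 ↦ h0 (by rw [h2] at h1; linarith)
    exact ⟨h2, by field_simp; linarith, fun h3 ↦ h0 (by rw [h3] at h1; linarith)⟩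
  -- At events with the same state, the same `s` gives the same quotient `-s'_ρ / s'_p`.
  have hfac : T.indicatrix.FactorsThrough T.state := by
    intro x y hxy
    obtain ⟨r, s, U, hx, -, hU, hev⟩ := hloc x
    have h1 := (hquot (hU _ hx).2.2.2.2 (hev x hx).2).2.1
    rw [hxy] at hx h1
    exact h1.trans (hquot (hU _ hx).2.2.2.2 (hev y hx).2).2.1.symm
  -- The value `0` off the set of states is immaterial: smoothness is needed only on that open set.
  let χ : ℝ × ℝ → ℝ := Function.extend T.state T.indicatrix 0
  have hχ : ∀ x, T.indicatrix x = χ (T.state x) := fun x ↦ (hfac.extend_apply 0 x).symm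
  have hopen := T.isOpen_range_state hbar
  have hsmooth : ∀ x, ContDiffAt ℝ ∞ χ (T.state x) := by
    intro x
    obtain ⟨r, s, U, hx, hUo, hU, hev⟩ := hloc x
    have h0 := hquot (hU _ hx).2.2.2.2 (hev x hx).2
    have hs := (hU _ hx).2.1.fderiv_right (m := ∞) (by simp)
    refine ((hs.clm_apply (contDiffAt_const (c := ((1 : ℝ), (0 : ℝ))))).neg.div
      (hs.clm_apply (contDiffAt_const (c := ((0 : ℝ), (1 : ℝ))))) h0.1).congr_of_eventuallyEq ?_
    filter_upwards [hUo.mem_nhds hx, hopen.mem_nhds ⟨x, rfl⟩]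
    rintro _ hy ⟨y, rfl⟩
    rw [← hχ]
    exact (hquot (hU _ hy).2.2.2.2 (hev y hy).2).2.1
  refine ⟨χ, ⟨⟨Set.range T.state, hopen, subset_rfl, ?_⟩, hχ⟩, fun x ↦ ?_⟩
  · rintro _ ⟨x, rfl⟩
    exact (hsmooth x).contDiffWithinAt
  · obtain ⟨r, s, U, hx, hUo, hU, hev⟩ := hloc x
    have hsound : SoundOn χ r s (U ∩ Set.range T.state) := by
      refine ⟨hUo.inter hopen, fun e he ↦ (hU e he.1).1, fun e he ↦ (hU e he.1).2.1, ?_, ?_,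
        fun e he ↦ (hU e he.1).2.2.1, ?_, ?_, ?_⟩
      · rintro _ ⟨-, y, rfl⟩
        exact hsmooth y
      · rintro _ ⟨-, y, rfl⟩
        exact hpos y
      · rintro _ ⟨hy, y, rfl⟩
        rw [← hχ]
        exact (hquot (hU _ hy).2.2.2.2 (hev y hy).2).2.2
      · rintro _ ⟨hy, y, rfl⟩
        rw [← hχ]
        exact (hev y hy).1
      · rintro _ ⟨hy, y, rfl⟩
        rw [← hχ]
        exact (hev y hy).2
    have hH := (hU _ hx).2.2.2.1
    exact (hsound.condH1_iff ⟨hx, x, rfl⟩ ⟨hH.choose, hH.choose_spec.1⟩).mp hH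

theorem RepresentsLTE.imp {C C' : (ℝ × ℝ → ℝ) → (ℝ × ℝ → ℝ) → ℝ × ℝ → Prop}
    (h : T.RepresentsLTE nabla C) (hC : ∀ r s e, C r s e → C' r s e) :
    T.RepresentsLTE nabla C' := fun x ↦
  let ⟨D, r, s, Θ, hx, hD, hev, hDC⟩ := h x
  ⟨D, r, s, Θ, hx, hD, hev, fun e he ↦ hC r s e (hDC e he)⟩

end PerfectEnergyTensor

end

theorem theorem5 {M : Type*} [TopologicalSpace M]
    [ChartedSpace (EuclideanSpace ℝ (Fin 4)) M] [IsManifold (𝓡 4) ∞ M]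
    (g : LorentzMetric M) (nabla : AffineConnection M) (hnabla : IsLeviCivita g nabla)
    (T : PerfectEnergyTensor g) (hpos : ∀ x, 0 < T.ρ x + T.p x)
    (hcons : T.IsConserved nabla) (hbar : T.IsNonBarotropic) (hiso : T.IsNonIsoenergetic) :
    (T.RepresentsLTE nabla (fun r s e ↦ CondH1 r s e ∧ CondH2 r s e) ↔
      ∃ χ : ℝ × ℝ → ℝ, T.IndicatrixEq χ ∧ ∀ x, IndicatrixH1 χ (T.state x)) ∧
    (T.RepresentsLTE nabla (fun r s e ↦ CondH1 r s e ∧ CondH2bar r s e) ↔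
      ∃ χ : ℝ × ℝ → ℝ, T.IndicatrixEq χ ∧ ∀ x, IndicatrixH1 χ (T.state x)) ∧
    (∀ χ : ℝ × ℝ → ℝ, T.IndicatrixEq χ → (∀ x, IndicatrixH1 χ (T.state x)) →
      T.CanBeEndowed nabla χ (fun r s e ↦ CondH1 r s e ∧ CondH2 r s e) ∧
      T.CanBeEndowed nabla χ (fun r s e ↦ CondH1 r s e ∧ CondH2bar r s e)) := by
  have h2 := fun χ hχ hH1 ↦ PerfectEnergyTensor.canBeEndowed_condH2 hnabla hcons hiso hpos hbar
    (χ := χ) hχ hH1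
  have h2bar := fun χ hχ hH1 ↦ PerfectEnergyTensor.canBeEndowed_condH2bar hnabla hcons hiso hpos
    hbar (χ := χ) hχ hH1
  refine ⟨⟨fun h ↦ ?_, ?_⟩, ⟨fun h ↦ ?_, ?_⟩, fun χ hχ hH1 ↦ ⟨h2 χ hχ hH1, h2bar χ hχ hH1⟩⟩
  · exact PerfectEnergyTensor.exists_indicatrixEq hnabla hcons hiso hpos hbar
      (h.imp fun _ _ _ ↦ And.left)
  · rintro ⟨χ, hχ, hH1⟩
    exact (h2 χ hχ hH1).representsLTE
  · exact PerfectEnergyTensor.exists_indicatrixEq hnabla hcons hiso hpos hbar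
      (h.imp fun _ _ _ ↦ And.left)
  · rintro ⟨χ, hχ, hH1⟩
    exact (h2bar χ hχ hH1).representsLTE
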